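/- Let $\tau$ be in the upper half plane and $\Lambda=\mathbb Z+\mathbb Z\tau$, with Weierstrass functions $\wp,\zeta,\sigma$. Let $p_1,\dots,p_r\in\mathbb C$ be pairwise distinct modulo $\Lambda$, let $n_1,\dots,n_r\in\{0,\tfrac12,1,\tfrac32,\dots\}$ with $\sum_i n_i\in\mathbb Z$, and let $A_1,\dots,A_r,B\in\mathbb C$ with $\sum_i A_i=0$. Consider the generalized Lamé equation $$w''=Qw,\qquad Q(z)=\sum_{i=1}^r n_i(n_i+1)\,\wp(z-p_i)+\sum_{i=1}^r A_i\,\zeta(z-p_i)+B ,$$ whose local exponents at $p_i$ are $-n_i$ and $n_i+1$. Suppose that all its solutions are log-free, i.e. for each $i$ every solution near $p_i$ (on a slit disc around $p_i$) has the form $(z-p_i)^{-n_i}h_1(z)+(z-p_i)^{n_i+1}h_2(z)$ near $p_i$ with $h_1,h_2$ holomorphic at $p_i$. Then one of its solutions is given by a generalized Hermite–Halphen ansatz, possibly of lower total weight: there are $n_i'\in\{n_i,\,-n_i-1\}$ $(1\le i\le r)$ with total weight $N:=\sum_i n_i'\in\mathbb Z_{\ge0}$, points $a_1,\dots,a_N\in\mathbb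 C$ that are pairwise distinct modulo $\Lambda$ and satisfy $a_\mu\not\equiv p_i \pmod\Lambda$ for all $\mu,i$, and a constant $h\in\mathbb C$, where $$h=\frac1N\sum_{\mu=1}^N\sum_{i=1}^r n_i'\,\zeta(a_\mu-p_i)\qquad\text{if } N>0,$$ such that the multi-valued function $$w(z)=e^{hz}\,\frac{\prod_{\mu=1}^N\sigma(z-a_\mu)}{\prod_{i=1}^r\sigma(z-p_i)^{n_i'}}$$ on $\mathbb C\setminus(\{p_1,\dots,p_r\}+\Lambda)$ is a solution of $w''=Qw$ (that is, every holomorphic branch of it is). -/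

import Mathlib

open Complex Filter Topology

noncomputable section

namespace GenLame

/-- The pair of periods `1, τ`, which spans the lattice `Λ_τ = ℤ + ℤ τ`. -/
def periods (τ : UpperHalfPlane) : PeriodPair where
  ω₁ := 1
  ω₂ := (τ : ℂ)
  indep := by
    rw [LinearIndependent.pair_iff]
    intro s t h
    have him := congrArg Complex.im h
    have hre := congrArg Complex.re h
    have hτ : (τ : ℂ).im ≠ 0 := τ.im_ne_zero
    simp only [Complex.add_im, Complex.real_smul, Complex.mul_im, Complex.ofReal_re,
      Complex.ofReal_im, Complex.one_im, Complex.one_re, Complex.zero_im, mul_zero, zero_mul,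
      add_zero, zero_add, mul_eq_zero, hτ, or_false] at him
    subst him
    simpa using hre

/-- The Weierstrass zeta function
`ζ(z) = 1/z + ∑_{l ∈ Λ, l ≠ 0} (1/(z-l) + 1/l + z/l²)`.
The term `l = 0` of the sum below is `1/z`, because `1/0 = z/0 = 0` in Lean. -/
def zeta (L : PeriodPair) (z : ℂ) : ℂ :=
  ∑' l : L.lattice, (1 / (z - l) + 1 / (l : ℂ) + z / (l : ℂ) ^ 2)

/-- The Weierstrass sigma function
`σ(z) = z ∏_{l ∈ Λ, l ≠ 0} (1 - z/l) exp(z/l + z²/(2l²))`.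
The factor `l = 0` of the product below is `1`, because `z/0 = 0` in Lean. -/
def sigma (L : PeriodPair) (z : ℂ) : ℂ :=
  z * ∏' l : L.lattice, ((1 - z / l) * exp (z / l + z ^ 2 / (2 * (l : ℂ) ^ 2)))

/-- The potential `Q(z) = ∑ n_i (n_i + 1) ℘(z - p_i) + ∑ A_i ζ(z - p_i) + B` of the generalized
Lamé equation `w'' = Q w`. -/
def potential (L : PeriodPair) {r : ℕ} (n p A : Fin r → ℂ) (B : ℂ) (z : ℂ) : ℂ :=
  ∑ i, n i * (n i + 1) * L.weierstrassP (z - p i) + ∑ i, A i * zeta L (z - p i) + B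

/-- `w` is a (single-valued, holomorphic) solution of `w'' = Q w` on the open set `U`. -/
def IsSolutionOn (Q : ℂ → ℂ) (U : Set ℂ) (w : ℂ → ℂ) : Prop :=
  DifferentiableOn ℂ w U ∧ ∀ z ∈ U, deriv (deriv w) z = Q z * w z

/-- The disc of radius `ε` around `p`, slit along the ray from `p` to the left. -/
def slitDisc (p : ℂ) (ε : ℝ) : Set ℂ :=
  {z | z ∈ Metric.ball p ε ∧ z - p ∈ slitPlane}

/-- All solutions of `w'' = Q w` near `p`, where the local exponents are `-n` and `n + 1`, are free
of logarithms: every solution on a slit disc around `p` is, near `p`, of the form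
`(z - p)^(-n) h₁(z) + (z - p)^(n+1) h₂(z)` with `h₁`, `h₂` holomorphic at `p`. -/
def LogFreeAt (Q : ℂ → ℂ) (p n : ℂ) : Prop :=
  ∀ ε : ℝ, 0 < ε → ∀ w : ℂ → ℂ, IsSolutionOn Q (slitDisc p ε) w →
    ∃ h₁ h₂ : ℂ → ℂ, AnalyticAt ℂ h₁ p ∧ AnalyticAt ℂ h₂ p ∧
      ∀ᶠ z in 𝓝 p, z - p ∈ slitPlane →
        w z = (z - p) ^ (-n) * h₁ z + (z - p) ^ (n + 1) * h₂ z

/-- `w` is a branch on `U` of the multi-valued function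
`exp(h z) ∏ σ(z - a_μ) / ∏ σ(z - p_i)^(ν_i)`, where `σ(z - p_i)^(ν_i)` is read as
`exp(ν_i ℓ_i(z))` for some holomorphic logarithm `ℓ_i` of `σ(z - p_i)` on `U`. -/
def IsBranchOn (L : PeriodPair) {r N : ℕ} (ν p : Fin r → ℂ) (a : Fin N → ℂ) (h : ℂ)
    (U : Set ℂ) (w : ℂ → ℂ) : Prop :=
  ∃ ℓ : Fin r → ℂ → ℂ,
    (∀ i, DifferentiableOn ℂ (ℓ i) U ∧ ∀ z ∈ U, exp (ℓ i z) = sigma L (z - p i)) ∧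
    ∀ z ∈ U, w z = exp (h * z) * (∏ μ, sigma L (z - a μ)) / ∏ i, exp (ν i * ℓ i z)

/-- The multi-valued function `exp(h z) ∏ σ(z - a_μ) / ∏ σ(z - p_i)^(ν_i)` solves `w'' = Q w`:
it has a branch near each point outside `{p_1, …, p_r} + Λ`, and each of its branches on an open set
is a solution there. -/
def IsMultivaluedSolution (L : PeriodPair) {r N : ℕ} (Q : ℂ → ℂ) (ν p : Fin r → ℂ)
    (a : Fin N → ℂ) (h : ℂ) : Prop :=
  (∀ z₀ : ℂ, (∀ i, z₀ - p i ∉ L.lattice) →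
    ∃ U : Set ℂ, IsOpen U ∧ z₀ ∈ U ∧ ∃ w : ℂ → ℂ, IsBranchOn L ν p a h U w) ∧
  ∀ U : Set ℂ, IsOpen U → ∀ w : ℂ → ℂ, IsBranchOn L ν p a h U w → IsSolutionOn Q U w

/-- `(a, h)` are admissible data for a generalized Hermite–Halphen ansatz of weights `ν` and total
weight `N`: the weights sum to `N`, the `a_μ` are distinct modulo `Λ` and different from the `p_i`
modulo `Λ`, and `h = (1/N) ∑_μ ∑_i ν_i ζ(a_μ - p_i)` if `N > 0` (`h` is arbitrary if `N = 0`). -/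
structure IsAnsatzData (L : PeriodPair) {r N : ℕ} (ν p : Fin r → ℂ) (a : Fin N → ℂ) (h : ℂ) :
    Prop where
  total_weight : ∑ i, ν i = N
  distinct : ∀ μ κ, μ ≠ κ → a μ - a κ ∉ L.lattice
  regular : ∀ μ i, a μ - p i ∉ L.lattice
  exponent : 0 < N → h = (1 / (N : ℂ)) * ∑ μ, ∑ i, ν i * zeta L (a μ - p i)

end GenLame

end

noncomputable section

namespace GenLame

/-! Put `E = ∏ σ(z - p_i)^(n_i)` and `P = E'/E = ∑ n_i ζ(z - p_i)`. For `y = w E` the equation `w''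
= Q w` becomes `y'' - 2 P y' + (P² - P' - Q) y = 0`, whose exponents at `p_i` are `0` and `2 n_i +
1`. These are nonnegative integers, so freedom of logarithms makes every local solution `y`
holomorphic (`hasLocalBasis_of_logFree`). Local bases of holomorphic solutions exist at all points
of the simply connected plane, hence a germ continues to an entire solution
(`GoodEquation.exists_entire`).

`Q` is elliptic because `∑ A_i = 0`, while `P` changes by the constant `(∑ n_i) η_ω` under `z ↦ z +
ω`. Translations twisted by a compensating exponential therefore act on the finite-dimensional space
of entire solutions. The two generators commute since `∑ n_i` is an integer and `η₁ ω₂ - η₂ ω₁ ∈ 2πi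
ℤ`. A common eigenvector `y` transforms like a product of `∑ n_i` sigma functions, up to constants
(`exists_quasiperiodic_solution`).

The zeros of `y` outside `p_i + Λ` are simple, and its order `k_i` at `p_i` is `0` or `2 n_i + 1`.
Dividing by the sigma product with the same zeros leaves a nowhere vanishing entire function with
quasi-periodicity of weight `∑ (n_i - k_i) - N`. Liouville's theorem and `η₁ ω₂ ≠ η₂ ω₁` force this
weight to be `0` and the function to be `C exp(h z)` (`exists_factorization`). So `w = y / E` is the
ansatz with `n_i' = n_i - k_i`, that is `n_i` or `-n_i - 1`. The equation at each simple zero `a_μ`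
gives a relation for `h`; averaging over `μ` cancels the terms `ζ(a_μ - a_κ)` (`exponent_eq`). -/

/-! ### The Weierstrass zeta function -/

lemma zeta_summand_eq (z l : ℂ) (hl : l ≠ 0) (hz : z ≠ l) :
    1 / (z - l) + 1 / l + z / l ^ 2 = z ^ 2 / (l ^ 2 * (z - l)) := by
  have : z - l ≠ 0 := sub_ne_zero.2 hz
  field_simp
  ring

lemma norm_zeta_summand_le {r : ℝ} (hr : 0 < r) {z l : ℂ} (hz : ‖z‖ < r) (hl : 2 * r ≤ ‖l‖) :
    ‖1 / (z - l) + 1 / l + z / l ^ 2‖ ≤ 2 * r ^ 2 * ‖l‖ ^ (-3 : ℝ) := by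
  have hl0 : 0 < ‖l‖ := by linarith
  have hzl : z ≠ l := by rintro rfl; linarith
  rw [zeta_summand_eq z l (norm_pos_iff.1 hl0) hzl]
  have h1 : ‖l‖ / 2 ≤ ‖z - l‖ := by
    rw [norm_sub_rev]; exact .trans (by linarith) (norm_sub_norm_le l z)
  calc ‖z ^ 2 / (l ^ 2 * (z - l))‖ = ‖z‖ ^ 2 / (‖l‖ ^ 2 * ‖z - l‖) := by simp
    _ ≤ r ^ 2 / (‖l‖ ^ 2 * (‖l‖ / 2)) := by gcongr
    _ = 2 * r ^ 2 / ‖l‖ ^ 3 := by field_simp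
    _ = _ := by norm_cast

lemma summable_norm_rpow (L : PeriodPair) : Summable fun l : L.lattice ↦ ‖l‖ ^ (-3 : ℝ) := by
  convert ZLattice.summable_norm_rpow L.lattice (-3 : ℝ) ?_ using 1
  simp; norm_num

lemma hasSumLocallyUniformly_zeta (L : PeriodPair) :
    HasSumLocallyUniformly (fun (l : L.lattice) (z : ℂ) ↦ 1 / (z - l) + 1 / (l : ℂ) + z / (l : ℂ) ^ 2)
      (zeta L) := by
  refine L.hasSumLocallyUniformly_aux _ (fun r l ↦ 2 * r ^ 2 * ‖l‖ ^ (-3 : ℝ))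
    (fun r _ ↦ (summable_norm_rpow L).mul_left _) fun r hr ↦ ?_
  filter_upwards [eventually_ge_atTop (2 * r)] with R hR z hz l hl
  exact norm_zeta_summand_le hr hz (hl ▸ hR)

lemma sub_ne_zero_of_notMem {L : PeriodPair} {z : ℂ} (hz : z ∉ L.lattice) (l : L.lattice) :
    z - l ≠ 0 := by
  rw [sub_ne_zero]; rintro rfl; exact hz l.2

lemma hasDerivAt_zeta_summand {L : PeriodPair} {z : ℂ} (hz : z ∉ L.lattice) (l : L.lattice) :
    HasDerivAt (fun z : ℂ ↦ 1 / (z - l) + 1 / (l : ℂ) + z / (l : ℂ) ^ 2)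
      (-(1 / (z - l) ^ 2 - 1 / (l : ℂ) ^ 2)) z := by
  have h := sub_ne_zero_of_notMem hz l
  have h1 : HasDerivAt (fun z : ℂ ↦ z - l) 1 z := (hasDerivAt_id z).sub_const _
  have := ((h1.inv h).add_const (1 / (l : ℂ))).add ((hasDerivAt_id z).div_const ((l : ℂ) ^ 2))
  simp only [one_div]
  simp only [one_div] at this
  refine this.congr_deriv ?_
  rw [← one_div, ← one_div]; ring

lemma isOpen_compl_lattice (L : PeriodPair) : IsOpen ((L.lattice : Set ℂ)ᶜ) :=
  L.isClosed_lattice.isOpen_compl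

lemma hasDerivAt_zeta {L : PeriodPair} {z : ℂ} (hz : z ∉ L.lattice) :
    HasDerivAt (zeta L) (-L.weierstrassP z) z := by
  have hU := isOpen_compl_lattice L
  have hd : ∀ᶠ s : Finset L.lattice in atTop, DifferentiableOn ℂ
      (fun z ↦ ∑ l ∈ s, (1 / (z - l) + 1 / (l : ℂ) + z / (l : ℂ) ^ 2)) (L.lattice : Set ℂ)ᶜ := by
    refine .of_forall fun s ↦ .fun_sum fun l _ x hx ↦ ?_
    exact (hasDerivAt_zeta_summand hx l).differentiableAt.differentiableWithinAt
  have ht : TendstoLocallyUniformlyOn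
      (fun (s : Finset L.lattice) z ↦ ∑ l ∈ s, (1 / (z - l) + 1 / (l : ℂ) + z / (l : ℂ) ^ 2))
      (zeta L) atTop (L.lattice : Set ℂ)ᶜ :=
    (hasSumLocallyUniformly_zeta L).hasSumLocallyUniformlyOn
  have h1 := (ht.deriv hd hU).tendsto_at hz
  have h2 : Tendsto (fun s : Finset L.lattice ↦ -∑ l ∈ s, (1 / (z - l) ^ 2 - 1 / (l : ℂ) ^ 2)) atTop
      (𝓝 (-L.weierstrassP z)) := 
    Tendsto.neg (L.hasSum_weierstrassP z)
  have h3 : deriv (zeta L) z = -L.weierstrassP z := by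
    refine tendsto_nhds_unique h1 (h2.congr fun s ↦ ?_)
    rw [Function.comp_apply, ← Finset.sum_neg_distrib]
    exact (HasDerivAt.fun_sum fun l _ ↦ hasDerivAt_zeta_summand hz l).deriv.symm
  rw [← h3]
  exact ((ht.differentiableOn hd hU).differentiableAt (hU.mem_nhds hz)).hasDerivAt

lemma hasSum_zeta (L : PeriodPair) (z : ℂ) :
    HasSum (fun l : L.lattice ↦ 1 / (z - l) + 1 / (l : ℂ) + z / (l : ℂ) ^ 2) (zeta L z) :=
  (hasSumLocallyUniformly_zeta L).hasSum

lemma zeta_neg (L : PeriodPair) (z : ℂ) : zeta L (-z) = -zeta L z := by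
  rw [zeta, ← (Equiv.neg L.lattice).tsum_eq, zeta, ← tsum_neg]
  refine tsum_congr fun l ↦ ?_
  simp only [Equiv.neg_apply, NegMemClass.coe_neg, neg_sq]
  rw [show -z - -(l : ℂ) = -(z - l) by ring, div_neg, div_neg, neg_div]
  ring

lemma isPreconnected_compl_of_countable {s : Set ℂ} (hs : s.Countable) : IsPreconnected sᶜ :=
  (hs.isPathConnected_compl_of_one_lt_rank (by simp)).isConnected.isPreconnected

lemma countable_lattice (L : PeriodPair) : (L.lattice : Set ℂ).Countable :=
  have : Countable L.lattice := Countable.of_equiv _ L.latticeEquivProd.symm.toEquiv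
  Set.to_countable (L.lattice : Set ℂ)

lemma add_notMem {L : PeriodPair} {z ω : ℂ} (hω : ω ∈ L.lattice) (hz : z ∉ L.lattice) :
    z + ω ∉ L.lattice := fun h ↦ hz (by simpa using L.lattice.sub_mem h hω)

/-- The quasi-period `η_ω` of the Weierstrass zeta function. -/
def quasiPeriod (L : PeriodPair) (ω : ℂ) : ℂ :=
  zeta L (L.ω₁ / 2 + ω) - zeta L (L.ω₁ / 2)

/-- `ζ(z + ω) - ζ(z)` has derivative `℘(z) - ℘(z + ω) = 0` on the complement of the countable
lattice, which is connected. -/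
lemma zeta_add {L : PeriodPair} {z ω : ℂ} (hω : ω ∈ L.lattice) (hz : z ∉ L.lattice) :
    zeta L (z + ω) = zeta L z + quasiPeriod L ω := by
  have key : ∀ x ∉ L.lattice, HasDerivAt (fun z ↦ zeta L (z + ω) - zeta L z) 0 x := by
    intro x hx
    have h := ((hasDerivAt_zeta (add_notMem hω hx)).comp_add_const x ω).sub (hasDerivAt_zeta hx)
    refine h.congr_deriv ?_
    rw [L.weierstrassP_add_coe x ⟨ω, hω⟩]; ring
  have := (isOpen_compl_lattice L).is_const_of_deriv_eq_zero
    (isPreconnected_compl_of_countable (countable_lattice L))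
    (fun x hx ↦ (key x hx).differentiableAt.differentiableWithinAt)
    (fun x hx ↦ (key x hx).deriv) hz L.ω₁_div_two_notMem_lattice
  rw [quasiPeriod, ← this]; ring

/-! ### The Weierstrass sigma function and the Legendre relation -/

/-- The Weierstrass elementary factor of genus two is `1` up to a cubic error near `0`. -/
lemma norm_elementary_sub_one_le {u : ℂ} (hu : ‖u‖ ≤ 1) :
    ‖(1 - u) * exp (u + u ^ 2 / 2) - 1‖ ≤ Real.exp 2 * ‖u‖ ^ 3 := by
  have hd : ∀ x : ℂ, HasDerivAt (fun u : ℂ ↦ (1 - u) * exp (u + u ^ 2 / 2))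
      (-(x ^ 2 * exp (x + x ^ 2 / 2))) x := by
    intro x
    have h1 : HasDerivAt (fun u : ℂ ↦ u + u ^ 2 / 2) (1 + x) x := by
      refine ((hasDerivAt_id x).add ((hasDerivAt_pow 2 x).div_const 2)).congr_deriv ?_
      simp
    refine (((hasDerivAt_id x).const_sub 1).mul h1.cexp).congr_deriv ?_
    simp only [id]; ring
  -- On the disc of radius `‖u‖ ≤ 1` the derivative is at most `‖u‖² e²`; the mean value inequality
  -- supplies the third factor `‖u‖`.
  have := (convex_closedBall (0 : ℂ) ‖u‖).norm_image_sub_le_of_norm_hasDerivWithin_le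
    (f := fun u : ℂ ↦ (1 - u) * exp (u + u ^ 2 / 2)) (C := ‖u‖ ^ 2 * Real.exp 2)
    (fun x _ ↦ (hd x).hasDerivWithinAt) (fun x hx ↦ ?_) (x := 0) (y := u) (by simp) (by simp)
  · simp only [sub_zero, one_mul] at this
    norm_num at this
    linarith
  · have hx : ‖x‖ ≤ ‖u‖ := by simpa using hx
    rw [norm_neg, norm_mul, norm_pow, norm_exp]
    gcongr
    have h1 : (x + x ^ 2 / 2).re ≤ ‖x + x ^ 2 / 2‖ := re_le_norm _
    have h2 : ‖x + x ^ 2 / 2‖ ≤ ‖x‖ + ‖x‖ ^ 2 / 2 := by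
      refine (norm_add_le _ _).trans ?_
      simp
    nlinarith [norm_nonneg x]

/-- The factors of the product defining the sigma function. -/
def sigmaFactor {L : PeriodPair} (l : L.lattice) (z : ℂ) : ℂ :=
  (1 - z / l) * exp (z / l + z ^ 2 / (2 * (l : ℂ) ^ 2))

lemma norm_sigmaFactor_sub_one_le {L : PeriodPair} {r : ℝ} (hr : 0 < r) {l : L.lattice} {z : ℂ}
    (hz : ‖z‖ < r) (hl : 2 * r ≤ ‖(l : ℂ)‖) :
    ‖sigmaFactor l z - 1‖ ≤ Real.exp 2 * r ^ 3 * ‖l‖ ^ (-3 : ℝ) := by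
  have hl0 : 0 < ‖(l : ℂ)‖ := by linarith
  have h1 : ‖z / l‖ ≤ r / ‖(l : ℂ)‖ := by rw [norm_div]; gcongr
  have h2 : r / ‖(l : ℂ)‖ ≤ 1 := by rw [div_le_one hl0]; linarith
  have h3 := norm_elementary_sub_one_le (h1.trans h2)
  rw [sigmaFactor, show z ^ 2 / (2 * (l : ℂ) ^ 2) = (z / l) ^ 2 / 2 by rw [div_pow]; ring]
  refine h3.trans ?_
  calc Real.exp 2 * ‖z / l‖ ^ 3 ≤ Real.exp 2 * (r / ‖(l : ℂ)‖) ^ 3 := by gcongr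
    _ = Real.exp 2 * r ^ 3 * ‖(l : ℂ)‖ ^ (-3 : ℝ) := by
      rw [div_pow, mul_assoc, div_eq_mul_inv, Real.rpow_neg (norm_nonneg _)]
      norm_cast
    _ = _ := rfl

lemma differentiable_sigmaFactor {L : PeriodPair} (l : L.lattice) :
    Differentiable ℂ (sigmaFactor l) := by
  unfold sigmaFactor
  fun_prop


lemma eventually_le_norm_lattice (L : PeriodPair) (R : ℝ) :
    ∀ᶠ l : L.lattice in cofinite, R ≤ ‖(l : ℂ)‖ := by
  refine (isCompact_iff_finite.mp (isCompact_closedBall (0 : L.lattice) R)).subset fun l hl ↦ ?_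
  simp only [Set.mem_compl_iff, Set.mem_ofPred_eq, not_le] at hl
  simpa using hl.le

lemma summable_sigmaFactor_sub_one (L : PeriodPair) (z : ℂ) :
    Summable fun l : L.lattice ↦ ‖sigmaFactor l z - 1‖ := by
  have hr : 0 < ‖z‖ + 1 := by positivity
  refine ((summable_norm_rpow L).mul_left (Real.exp 2 * (‖z‖ + 1) ^ 3)).of_norm_bounded_eventually ?_
  filter_upwards [eventually_le_norm_lattice L (2 * (‖z‖ + 1))] with l hl
  rw [norm_norm]
  exact norm_sigmaFactor_sub_one_le hr (by linarith) hl

lemma multipliableLocallyUniformlyOn_sigmaFactor (L : PeriodPair) {r : ℝ} (hr : 0 < r) :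
    MultipliableLocallyUniformlyOn (fun (l : L.lattice) z ↦ sigmaFactor l z) (Metric.ball 0 r) := by
  have := Summable.multipliableLocallyUniformlyOn_one_add (K := Metric.ball (0 : ℂ) r)
    (f := fun (l : L.lattice) z ↦ sigmaFactor l z - 1) Metric.isOpen_ball
    ((summable_norm_rpow L).mul_left (Real.exp 2 * r ^ 3)) ?_ ?_
  · simpa using this
  · filter_upwards [eventually_le_norm_lattice L (2 * r)] with l hl z hz
    exact norm_sigmaFactor_sub_one_le hr (by simpa using hz) hl
  · exact fun l ↦ ((differentiable_sigmaFactor l).continuous.sub continuous_const).continuousOn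

lemma differentiable_tprod_sigmaFactor (L : PeriodPair) :
    Differentiable ℂ fun z ↦ ∏' l : L.lattice, sigmaFactor l z := by
  intro z
  have hr : 0 < ‖z‖ + 1 := by positivity
  have h := (multipliableLocallyUniformlyOn_sigmaFactor L hr).hasProdLocallyUniformlyOn
  have := TendstoLocallyUniformlyOn.differentiableOn h (.of_forall fun s ↦
    DifferentiableOn.fun_finsetProd fun l _ ↦ (differentiable_sigmaFactor l).differentiableOn)
    Metric.isOpen_ball
  exact this.differentiableAt (Metric.isOpen_ball.mem_nhds (by simp))

lemma sigma_eq (L : PeriodPair) :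
    sigma L = fun z ↦ z * ∏' l : L.lattice, sigmaFactor l z := rfl

lemma differentiable_sigma (L : PeriodPair) : Differentiable ℂ (sigma L) :=
  differentiable_id.mul (differentiable_tprod_sigmaFactor L)

@[simp] lemma sigma_zero (L : PeriodPair) : sigma L 0 = 0 := by simp [sigma]

lemma deriv_sigma_zero (L : PeriodPair) : deriv (sigma L) 0 = 1 := by
  have h := (hasDerivAt_id (0 : ℂ)).mul (differentiable_tprod_sigmaFactor L 0).hasDerivAt
  refine (HasDerivAt.deriv (f := sigma L) h).trans ?_
  simp [sigmaFactor]

lemma sigmaFactor_ne_zero {L : PeriodPair} {z : ℂ} (hz : z ∉ L.lattice) (l : L.lattice) :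
    sigmaFactor l z ≠ 0 := by
  refine mul_ne_zero ?_ (exp_ne_zero _)
  intro h
  have h1 : z / l = 1 := (sub_eq_zero.1 h).symm
  have hl : (l : ℂ) ≠ 0 := by intro h0; simp [h0] at h1
  rw [div_eq_one_iff_eq hl] at h1
  exact hz (h1 ▸ l.2)

lemma ne_zero_of_notMem {L : PeriodPair} {z : ℂ} (hz : z ∉ L.lattice) : z ≠ 0 := by
  rintro rfl; exact hz (zero_mem _)

lemma tprod_sigmaFactor_ne_zero {L : PeriodPair} {z : ℂ} (hz : z ∉ L.lattice) :
    ∏' l : L.lattice, sigmaFactor l z ≠ 0 := by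
  have := tprod_one_add_ne_zero_of_summable (f := fun l : L.lattice ↦ sigmaFactor l z - 1)
    (fun l ↦ by simpa using sigmaFactor_ne_zero hz l) (summable_sigmaFactor_sub_one L z)
  simpa using this

lemma sigma_ne_zero {L : PeriodPair} {z : ℂ} (hz : z ∉ L.lattice) : sigma L z ≠ 0 :=
  mul_ne_zero (ne_zero_of_notMem hz) (tprod_sigmaFactor_ne_zero hz)

lemma logDeriv_sigmaFactor {L : PeriodPair} {z : ℂ} (hz : z ∉ L.lattice) (l : L.lattice) :
    logDeriv (sigmaFactor l) z =
      if l = 0 then 0 else 1 / (z - l) + 1 / (l : ℂ) + z / (l : ℂ) ^ 2 := by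
  split_ifs with h0
  · subst h0
    have : sigmaFactor (0 : L.lattice) = fun _ ↦ (1 : ℂ) := by ext; simp [sigmaFactor]
    rw [this]; simp [logDeriv_apply]
  · have hl : (l : ℂ) ≠ 0 := by simpa using h0
    have hzl := sub_ne_zero_of_notMem hz l
    have h1 : HasDerivAt (fun z : ℂ ↦ 1 - z / l) (-(1 / l)) z :=
      ((hasDerivAt_id z).div_const (l : ℂ)).const_sub 1
    have h2 : HasDerivAt (fun z : ℂ ↦ z / l + z ^ 2 / (2 * (l : ℂ) ^ 2)) (1 / l + z / (l : ℂ) ^ 2) z := by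
      refine (((hasDerivAt_id z).div_const (l : ℂ)).add
        ((hasDerivAt_pow 2 z).div_const (2 * (l : ℂ) ^ 2))).congr_deriv ?_
      field_simp
      simp
      ring
    have h3 := h1.mul h2.cexp
    have h4 : 1 - z / l ≠ 0 := by
      intro h
      exact hzl (by field_simp at h; linear_combination -h)
    rw [logDeriv_apply, HasDerivAt.deriv (f := sigmaFactor l) h3, sigmaFactor,
      div_eq_iff (mul_ne_zero h4 (exp_ne_zero _))]
    field_simp
    ring

lemma hasDerivAt_sigma {L : PeriodPair} {z : ℂ} (hz : z ∉ L.lattice) :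
    HasDerivAt (sigma L) (zeta L z * sigma L z) z := by
  have hr : 0 < ‖z‖ + 1 := by positivity
  -- The factor at `l = 0` is constant, so its logarithmic derivative misses the term `1 / z` of
  -- `ζ`; the factor `z` of `σ` restores it.
  have hs : HasSum (fun l : L.lattice ↦
      if l = 0 then 0 else 1 / (z - l) + 1 / (l : ℂ) + z / (l : ℂ) ^ 2) (zeta L z - 1 / z) := by
    have h1 := hasSum_ite_eq (0 : L.lattice) (1 / z)
    refine ((hasSum_zeta L z).sub h1).congr_fun fun l ↦ ?_
    split_ifs with h <;> simp [h]
  have h1 := logDeriv_tprod_eq_tsum (s := Metric.ball 0 (‖z‖ + 1)) Metric.isOpen_ball (x := z) (by simp)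
    (f := fun l : L.lattice ↦ sigmaFactor l) (sigmaFactor_ne_zero hz)
    (fun l ↦ (differentiable_sigmaFactor l).differentiableOn)
    (by simpa only [logDeriv_sigmaFactor hz] using hs.summable)
    (multipliableLocallyUniformlyOn_sigmaFactor L hr) (tprod_sigmaFactor_ne_zero hz)
  simp only [logDeriv_sigmaFactor hz, hs.tsum_eq] at h1
  have h2 : logDeriv (sigma L) z = zeta L z := by
    rw [sigma_eq, logDeriv_mul z (ne_zero_of_notMem hz) (tprod_sigmaFactor_ne_zero hz)
      differentiableAt_fun_id (differentiable_tprod_sigmaFactor L z), h1]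
    simp [logDeriv_apply]
  rw [← h2, logDeriv_apply, div_mul_cancel₀ _ (sigma_ne_zero hz)]
  exact (differentiable_sigma L z).hasDerivAt

lemma sigma_neg (L : PeriodPair) (z : ℂ) : sigma L (-z) = -sigma L z := by
  rw [sigma_eq]
  simp only
  rw [neg_mul, ← (Equiv.neg L.lattice).tprod_eq]
  congr 2
  refine tprod_congr fun l ↦ ?_
  simp [sigmaFactor]

/-- The Weierstrass sigma function is quasi-periodic. -/
lemma exists_sigma_add {L : PeriodPair} {ω : ℂ} (hω : ω ∈ L.lattice) :
    ∃ C : ℂ, C ≠ 0 ∧ ∀ z, sigma L (z + ω) = C * exp (quasiPeriod L ω * z) * sigma L z := by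
  set η := quasiPeriod L ω
  -- The logarithmic derivative of this quotient is `ζ(x + ω) - η - ζ(x) = 0`.
  have key : ∀ x ∉ L.lattice,
      HasDerivAt (fun z ↦ sigma L (z + ω) / (exp (η * z) * sigma L z)) 0 x := by
    intro x hx
    have h1 := (hasDerivAt_sigma (add_notMem hω hx)).comp_add_const x ω
    have h2 : HasDerivAt (fun z ↦ exp (η * z)) (exp (η * x) * η) x := by
      simpa using ((hasDerivAt_id x).const_mul η).cexp
    have h3 := h2.mul (hasDerivAt_sigma hx)
    have hne : exp (η * x) * sigma L x ≠ 0 := mul_ne_zero (exp_ne_zero _) (sigma_ne_zero hx)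
    refine (h1.div h3 hne).congr_deriv ?_
    rw [div_eq_zero_iff]; left
    simp only [Pi.mul_apply]
    rw [zeta_add hω hx]; ring
  set C := sigma L (L.ω₁ / 2 + ω) / (exp (η * (L.ω₁ / 2)) * sigma L (L.ω₁ / 2)) with hC
  have hne : ∀ x ∉ L.lattice, exp (η * x) * sigma L x ≠ 0 := fun x hx ↦
    mul_ne_zero (exp_ne_zero _) (sigma_ne_zero hx)
  have hmain : ∀ z ∉ L.lattice, sigma L (z + ω) = C * exp (η * z) * sigma L z := by
    intro z hz
    have := (isOpen_compl_lattice L).is_const_of_deriv_eq_zero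
      (isPreconnected_compl_of_countable (countable_lattice L))
      (fun x hx ↦ (key x hx).differentiableAt.differentiableWithinAt)
      (fun x hx ↦ (key x hx).deriv) hz L.ω₁_div_two_notMem_lattice
    rw [mul_assoc, ← div_eq_iff (hne z hz), hC]
    exact this
  refine ⟨C, div_ne_zero (sigma_ne_zero (add_notMem hω L.ω₁_div_two_notMem_lattice))
    (hne _ L.ω₁_div_two_notMem_lattice), fun z ↦ ?_⟩
  have hd : Dense ((L.lattice : Set ℂ)ᶜ) := (countable_lattice L).dense_compl ℂ
  have hc := (differentiable_sigma L).continuous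
  refine congrFun (Continuous.ext_on hd (f := fun z ↦ sigma L (z + ω))
    (g := fun z ↦ C * exp (η * z) * sigma L z) (by fun_prop) (by fun_prop) hmain) z

lemma periodic_of_generators {L : PeriodPair} {X : Type*} {f : ℂ → X}
    (h₁ : Function.Periodic f L.ω₁) (h₂ : Function.Periodic f L.ω₂) {l : ℂ} (hl : l ∈ L.lattice) :
    Function.Periodic f l := by
  obtain ⟨m, n, rfl⟩ := PeriodPair.mem_lattice.1 hl
  exact (h₁.int_mul m).add_period (h₂.int_mul n)

lemma exists_lattice_norm_sub_le (L : PeriodPair) :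
    ∃ R : ℝ, ∀ z : ℂ, ∃ l ∈ L.lattice, ‖z - l‖ ≤ R := by
  refine ⟨∑ i, ‖L.basis i‖, fun z ↦ ⟨ZSpan.floor L.basis z, ?_, ZSpan.norm_fract_le L.basis z⟩⟩
  rw [L.lattice_eq_span_range_basis]
  exact (ZSpan.floor L.basis z).2

lemma sigma_eq_zero_iff (L : PeriodPair) (z : ℂ) : sigma L z = 0 ↔ z ∈ L.lattice := by
  refine ⟨fun h ↦ by_contra fun hz ↦ sigma_ne_zero hz h, fun h ↦ ?_⟩
  obtain ⟨C, -, hC⟩ := exists_sigma_add h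
  simpa using hC 0

lemma analyticAt_sigma (L : PeriodPair) (z : ℂ) : AnalyticAt ℂ (sigma L) z :=
  (differentiable_sigma L).analyticAt z

/-- Quasi-periodicity carries the simple zero at the origin to every lattice point. -/
lemma deriv_sigma_ne_zero {L : PeriodPair} {z : ℂ} (hz : z ∈ L.lattice) :
    deriv (sigma L) z ≠ 0 := by
  obtain ⟨C, hC0, hC⟩ := exists_sigma_add hz
  have h1 : HasDerivAt (fun x ↦ sigma L (x + z)) (deriv (sigma L) z) 0 := by
    have := (differentiable_sigma L z).hasDerivAt
    rw [← zero_add z] at this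
    simpa using this.comp_add_const 0 z
  have h2 : HasDerivAt (fun x ↦ C * exp (quasiPeriod L z * x) * sigma L x) C 0 := by
    have h3 : HasDerivAt (sigma L) 1 0 := by
      simpa [deriv_sigma_zero] using (differentiable_sigma L 0).hasDerivAt
    have h4 : HasDerivAt (fun x ↦ C * exp (quasiPeriod L z * x)) (C * quasiPeriod L z) 0 := by
      simpa using (((hasDerivAt_id (0 : ℂ)).const_mul (quasiPeriod L z)).cexp).const_mul C
    exact (h4.mul h3).congr_deriv (by simp)
  rw [← funext hC] at h2
  rwa [h1.unique h2]

lemma analyticOrderAt_sigma_sub (L : PeriodPair) (a c : ℂ) [Decidable (c - a ∈ L.lattice)] :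
    analyticOrderAt (fun z ↦ sigma L (z - a)) c = if c - a ∈ L.lattice then 1 else 0 := by
  have han : AnalyticAt ℂ (fun z ↦ sigma L (z - a)) c :=
    (analyticAt_sigma L (c - a)).comp_of_eq (by fun_prop) rfl
  split_ifs with h
  · have h1 : HasDerivAt (fun z ↦ sigma L (z - a)) (deriv (sigma L) (c - a)) c :=
      (differentiable_sigma L (c - a)).hasDerivAt.comp_sub_const c a
    have h2 := han.analyticOrderAt_sub_eq_one_of_deriv_ne_zero
      (by rw [h1.deriv]; exact deriv_sigma_ne_zero h)
    simpa [(sigma_eq_zero_iff L _).2 h] using h2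
  · rw [han.analyticOrderAt_eq_zero]
    exact sigma_ne_zero h

/-- The weak Legendre relation: `η₁ ω₂ - η₂ ω₁` is a multiple of `2 π i`. -/
lemma exp_legendre (L : PeriodPair) :
    exp (quasiPeriod L L.ω₁ * L.ω₂ - quasiPeriod L L.ω₂ * L.ω₁) = 1 := by
  obtain ⟨C₁, hC₁, h₁⟩ := exists_sigma_add L.ω₁_mem_lattice
  obtain ⟨C₂, hC₂, h₂⟩ := exists_sigma_add L.ω₂_mem_lattice
  set η₁ := quasiPeriod L L.ω₁
  set η₂ := quasiPeriod L L.ω₂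
  obtain ⟨z, hz⟩ : ∃ z, sigma L z ≠ 0 := ⟨_, sigma_ne_zero L.ω₁_div_two_notMem_lattice⟩
  -- `σ(z + ω₁ + ω₂)` is computed in the two possible orders and compared.
  have e₁ := h₁ (z + L.ω₂)
  have e₂ := h₂ (z + L.ω₁)
  rw [h₂ z] at e₁
  rw [h₁ z, add_right_comm, e₁] at e₂
  rw [mul_add, mul_add, exp_add, exp_add] at e₂
  rw [exp_sub, div_eq_one_iff_eq (exp_ne_zero _)]
  have : C₁ * C₂ * exp (η₁ * z) * exp (η₂ * z) * sigma L z ≠ 0 := by simp [hC₁, hC₂, hz]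
  apply mul_left_cancel₀ this
  linear_combination e₂

/-- Evaluation at `-ω/2`, where `σ` is nonzero and odd, determines the constant of
`exists_sigma_add`. -/
lemma sigma_add_period {L : PeriodPair} {ω : ℂ} (hω : ω ∈ L.lattice) (hω2 : ω / 2 ∉ L.lattice)
    (z : ℂ) :
    sigma L (z + ω) = -exp (quasiPeriod L ω * (z + ω / 2)) * sigma L z := by
  obtain ⟨C, hC0, hC⟩ := exists_sigma_add hω
  have h := hC (-(ω / 2))
  rw [sigma_neg, show -(ω / 2) + ω = ω / 2 by ring] at h
  have hs := sigma_ne_zero hω2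
  have hC' : C = -exp (quasiPeriod L ω * (ω / 2)) := by
    have h1 : (1 + C * exp (quasiPeriod L ω * -(ω / 2))) * sigma L (ω / 2) = 0 := by
      linear_combination h
    have h2 := (mul_eq_zero.1 h1).resolve_right hs
    rw [mul_neg, exp_neg] at h2
    have he := exp_ne_zero (quasiPeriod L ω * (ω / 2))
    generalize exp (quasiPeriod L ω * (ω / 2)) = E at h2 he ⊢
    field_simp at h2
    linear_combination h2
  rw [hC, hC', mul_add, exp_add]
  ring

lemma isBounded_range_of_periodic {L : PeriodPair} {f : ℂ → ℝ} (hf : Continuous f)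
    (h : ∀ l ∈ L.lattice, Function.Periodic f l) : ∃ M, ∀ z, f z ≤ M := by
  obtain ⟨R, hR⟩ := exists_lattice_norm_sub_le L
  obtain ⟨M, hM⟩ := (isCompact_closedBall (0 : ℂ) R).bddAbove_image hf.continuousOn
  refine ⟨M, fun z ↦ ?_⟩
  obtain ⟨l, hl, hz⟩ := hR z
  have := hM (Set.mem_image_of_mem f (x := z - l) (by simpa using hz))
  rwa [(h l hl).sub_eq] at this

/-- Otherwise `η_j = c ω_j` for both generators, and `σ(z) exp(-c z²/2)` is entire with doubly
periodic modulus. By Liouville it is constant, but it vanishes at `0` and not at `ω₁/2`. -/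
lemma legendre_ne (L : PeriodPair) :
    quasiPeriod L L.ω₁ * L.ω₂ ≠ quasiPeriod L L.ω₂ * L.ω₁ := by
  intro heq
  have hω₁ : L.ω₁ ≠ 0 := by
    intro h; apply L.ω₁_div_two_notMem_lattice; simp [h]
  set c := quasiPeriod L L.ω₁ / L.ω₁ with hc
  have hη₁ : quasiPeriod L L.ω₁ = c * L.ω₁ := by rw [hc]; field_simp
  have hη₂ : quasiPeriod L L.ω₂ = c * L.ω₂ := by
    rw [hc]; field_simp; linear_combination -heq
  set s : ℂ → ℂ := fun z ↦ sigma L z * exp (-c * z ^ 2 / 2) with hs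
  have hper : ∀ ω ∈ L.lattice, ω / 2 ∉ L.lattice → quasiPeriod L ω = c * ω →
      Function.Periodic (fun z ↦ ‖s z‖) ω := by
    intro ω h1 h2 h3 z
    have : s (z + ω) = -s z := by
      simp only [hs]
      rw [sigma_add_period h1 h2, h3]
      rw [show -c * (z + ω) ^ 2 / 2 = -c * z ^ 2 / 2 - c * ω * (z + ω / 2) by ring, exp_sub]
      field_simp
    simp only [this, norm_neg]
  have hsd : Differentiable ℂ s := (differentiable_sigma L).mul (by fun_prop)
  obtain ⟨M, hM⟩ := isBounded_range_of_periodic (L := L) hsd.continuous.norm fun l hl ↦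
    periodic_of_generators (hper _ L.ω₁_mem_lattice L.ω₁_div_two_notMem_lattice hη₁)
      (hper _ L.ω₂_mem_lattice L.ω₂_div_two_notMem_lattice hη₂) hl
  have hb : Bornology.IsBounded (Set.range s) :=
    isBounded_iff_forall_norm_le.2 ⟨M, by rintro _ ⟨z, rfl⟩; exact hM z⟩
  have h0 := hsd.apply_eq_apply_of_bounded hb (L.ω₁ / 2) 0
  simp only [hs, sigma_zero, zero_mul, mul_eq_zero, exp_ne_zero, or_false] at h0
  exact sigma_ne_zero L.ω₁_div_two_notMem_lattice h0

/-! ### Frobenius' method -/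

/-- With `σ = ρ (1 + C)` each of the `k` terms on the right is at most `M σ^k`, and the factor `k`
on the left absorbs their number. `M` is chosen to cover the indices below `k₀`, about which the
recursion says nothing. -/
lemma geometric_majorant {q u : ℕ → ℂ} {C ρ : ℝ} (hC : 0 ≤ C) (hρ : 0 < ρ)
    (hq : ∀ k, ‖q k‖ ≤ C * ρ ^ k) {k₀ : ℕ} (hk₀ : 1 ≤ k₀)
    (hu : ∀ k ≥ k₀, k * ‖u k‖ ≤ ∑ j ∈ Finset.range k, ‖q (k - j)‖ * ‖u j‖) :
    ∃ M σ : ℝ, 0 ≤ M ∧ 0 < σ ∧ ∀ k, ‖u k‖ ≤ M * σ ^ k := by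
  set σ := ρ * (1 + C) with hσ
  have hσ0 : 0 < σ := by positivity
  set M := ∑ j ∈ Finset.range k₀, ‖u j‖ / σ ^ j with hM
  have hM0 : 0 ≤ M := Finset.sum_nonneg fun j _ ↦ by positivity
  refine ⟨M, σ, hM0, hσ0, fun k ↦ ?_⟩
  induction k using Nat.strong_induction_on with
  | _ k ih =>
    rcases lt_or_ge k k₀ with hk | hk
    · have := Finset.single_le_sum (f := fun j ↦ ‖u j‖ / σ ^ j) (fun j _ ↦ by positivity)
        (Finset.mem_range.2 hk)
      rwa [← hM, div_le_iff₀ (by positivity)] at this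
    · have hk0 : (0 : ℝ) < k := by exact_mod_cast (by omega : 0 < k)
      have hterm : ∀ j ∈ Finset.range k, ‖q (k - j)‖ * ‖u j‖ ≤ M * σ ^ k := by
        intro j hj
        have hj := Finset.mem_range.1 hj
        obtain ⟨i, rfl⟩ : ∃ i, k = j + (i + 1) := ⟨k - j - 1, by omega⟩
        rw [Nat.add_sub_cancel_left]
        calc ‖q (i + 1)‖ * ‖u j‖ ≤ (C * ρ ^ (i + 1)) * (M * σ ^ j) := by
              gcongr
              · exact hq _
              · exact ih j hj
          _ = M * σ ^ j * (ρ ^ i * (ρ * C)) := by ring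
          _ ≤ M * σ ^ j * (σ ^ i * σ) := by
              have h1 : ρ ≤ σ := by rw [hσ]; nlinarith
              have h2 : ρ * C ≤ σ := by rw [hσ]; nlinarith
              gcongr
          _ = M * σ ^ (j + (i + 1)) := by ring
      have := (hu k hk).trans (Finset.sum_le_sum hterm)
      rw [Finset.sum_const, Finset.card_range, nsmul_eq_mul] at this
      exact le_of_mul_le_mul_left this hk0

/-- The sequence of coefficients in Frobenius' method. -/
def frobeniusCoeff (q : ℕ → ℂ) (b u₀ u₁ : ℂ) (k : ℕ) : ℂ :=
  if k = 0 then u₀ else if k = 1 then u₁ else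
    (∑ j : Fin k, q (k - j) * frobeniusCoeff q b u₀ u₁ j) / (k * (k + b))
termination_by k
decreasing_by exact j.2

lemma frobeniusCoeff_zero (q : ℕ → ℂ) (b u₀ u₁ : ℂ) : frobeniusCoeff q b u₀ u₁ 0 = u₀ := by
  rw [frobeniusCoeff]; simp

lemma frobeniusCoeff_one (q : ℕ → ℂ) (b u₀ u₁ : ℂ) : frobeniusCoeff q b u₀ u₁ 1 = u₁ := by
  rw [frobeniusCoeff]; simp

lemma frobeniusCoeff_of_two_le (q : ℕ → ℂ) (b u₀ u₁ : ℂ) {k : ℕ} (hk : 2 ≤ k) :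
    frobeniusCoeff q b u₀ u₁ k =
      (∑ j ∈ Finset.range k, q (k - j) * frobeniusCoeff q b u₀ u₁ j) / (k * (k + b)) := by
  rw [frobeniusCoeff, if_neg (by omega), if_neg (by omega),
    Finset.sum_range fun j ↦ q (k - j) * frobeniusCoeff q b u₀ u₁ j]

/-- The Euler operator `z d/dz` multiplies the `k`-th coefficient by `k` without shifting powers.
Applied twice it yields `z² u'' + z u'`, the form needed for the singular equation. -/
lemma hasSum_theta {v : ℕ → ℂ} {r : ℝ} (hv : Summable fun k ↦ ‖v k‖ * r ^ k) :
    DifferentiableOn ℂ (fun z ↦ ∑' k, v k * z ^ k) (Metric.ball 0 r) ∧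
    ∀ z ∈ Metric.ball (0 : ℂ) r,
      HasSum (fun k ↦ v k * z ^ k) (∑' k, v k * z ^ k) ∧
      HasSum (fun k ↦ (k * v k) * z ^ k) (z * deriv (fun z ↦ ∑' k, v k * z ^ k) z) := by
  have hb : ∀ (k : ℕ) (z : ℂ), z ∈ Metric.ball (0 : ℂ) r → ‖v k * z ^ k‖ ≤ ‖v k‖ * r ^ k := by
    intro k z hz
    rw [norm_mul, norm_pow]
    gcongr
    exact (mem_ball_zero_iff.1 hz).le
  have hd : ∀ k : ℕ, DifferentiableOn ℂ (fun z ↦ v k * z ^ k) (Metric.ball 0 r) := fun k ↦ by fun_prop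
  refine ⟨differentiableOn_tsum_of_summable_norm hv hd Metric.isOpen_ball hb, fun z hz ↦ ⟨?_, ?_⟩⟩
  · exact (Summable.of_norm_bounded hv fun k ↦ hb k z hz).hasSum
  · have h := (hasSum_deriv_of_summable_norm hv hd Metric.isOpen_ball hb hz).mul_left z
    refine h.congr_fun fun k ↦ ?_
    have : deriv (fun z : ℂ ↦ v k * z ^ k) z = v k * (k * z ^ (k - 1)) := by simp
    rw [this]
    rcases k with _ | k
    · simp
    · simp only [Nat.add_sub_cancel]; ring

lemma exists_coeff {q : ℂ → ℂ} (hq : AnalyticAt ℂ q 0) :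
    ∃ (a : ℕ → ℂ) (C ρ : ℝ), 0 ≤ C ∧ 0 < ρ ∧ (∀ k, ‖a k‖ ≤ C * ρ ^ k) ∧ a 0 = q 0 ∧
      a 1 = deriv q 0 ∧ ∀ᶠ z in 𝓝 0, HasSum (fun k ↦ a k * z ^ k) (q z) := by
  obtain ⟨p, hp⟩ := hq
  obtain ⟨r, hr0, hr⟩ := ENNReal.lt_iff_exists_nnreal_btwn.1 hp.radius_pos
  obtain ⟨C, hC0, hC⟩ := p.norm_le_div_pow_of_pos_of_lt_radius (by exact_mod_cast hr0) hr
  have hr0' : (0 : ℝ) < r := by exact_mod_cast hr0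
  refine ⟨p.coeff, C, (r : ℝ)⁻¹, hC0.le, by positivity, fun k ↦ ?_, ?_, ?_, ?_⟩
  · rw [inv_pow, ← div_eq_mul_inv]
    simpa using hC k
  · have := hp.coeff_zero (fun _ ↦ 1)
    rw [← this]; rfl
  · rw [hp.deriv]; rfl
  · filter_upwards [hasFPowerSeriesAt_iff.1 hp] with z hz
    simpa [mul_comm] using hz


/-- Comparing coefficients of `z^k` gives `k (k + b) v_k = ∑_{j<k} q_{k-j} v_j`. For `b = -1`, the
case of a regular point, index `1` is resonant; hence `v_1` is prescribed subject to `h₁`, and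
division occurs only for `k ≥ 2`. -/
lemma frobenius_at_zero {q : ℂ → ℂ} (hq : AnalyticAt ℂ q 0) {b u₀ u₁ : ℂ}
    (hb : ∀ k : ℕ, 2 ≤ k → 1 ≤ ‖(k : ℂ) + b‖) (h₁ : (1 + b) * u₁ = deriv q 0 * u₀) :
    ∃ u : ℂ → ℂ, AnalyticAt ℂ u 0 ∧ u 0 = u₀ ∧ deriv u 0 = u₁ ∧
      ∀ᶠ z in 𝓝 0, z ^ 2 * deriv (deriv u) z + (b + 1) * z * deriv u z = (q z - q 0) * u z := by
  obtain ⟨a, C, ρ, hC, hρ, ha, ha0, ha1, hsum⟩ := exists_coeff hq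
  set v := frobeniusCoeff a b u₀ u₁ with hv
  have hrec : ∀ k, k * (k + b) * v k = ∑ j ∈ Finset.range k, a (k - j) * v j := by
    intro k
    rcases lt_or_ge k 2 with hk | hk
    · interval_cases k
      · simp
      · simp [hv, frobeniusCoeff_zero, frobeniusCoeff_one, ha1, h₁]
    · have h1 : (k : ℂ) ≠ 0 := by exact_mod_cast (by omega : k ≠ 0)
      have h2 : (k : ℂ) + b ≠ 0 := norm_pos_iff.1 (one_pos.trans_le (hb k hk))
      rw [hv, frobeniusCoeff_of_two_le _ _ _ _ hk]
      field_simp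
  obtain ⟨M, σ, hM, hσ, hbound⟩ := geometric_majorant (u := v) (k₀ := 2) hC hρ ha (by norm_num) <| by
    intro k hk
    calc (k : ℝ) * ‖v k‖ ≤ k * ‖(k : ℂ) + b‖ * ‖v k‖ := by
          gcongr
          exact le_mul_of_one_le_right (by positivity) (hb k hk)
      _ = ‖∑ j ∈ Finset.range k, a (k - j) * v j‖ := by rw [← hrec]; simp
      _ ≤ _ := (norm_sum_le _ _).trans_eq (by simp)
  -- On this radius the series of `u` and of `q` are both dominated by multiples of `∑ 2^(-k)`.
  set r := min (1 / (2 * σ)) (1 / (2 * ρ)) with hr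
  have hr0 : 0 < r := by positivity
  have hσr : σ * r ≤ 1 / 2 := by
    calc σ * r ≤ σ * (1 / (2 * σ)) := by gcongr; exact min_le_left _ _
      _ = 1 / 2 := by field_simp
  have hρr : ρ * r ≤ 1 / 2 := by
    calc ρ * r ≤ ρ * (1 / (2 * ρ)) := by gcongr; exact min_le_right _ _
      _ = 1 / 2 := by field_simp
  have hle : ∀ k, ‖v k‖ * r ^ k ≤ M * (1 / 2) ^ k := fun k ↦ by
    calc ‖v k‖ * r ^ k ≤ M * σ ^ k * r ^ k := by gcongr; exact hbound k
      _ = M * (σ * r) ^ k := by ring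
      _ ≤ _ := by gcongr
  have hle' : ∀ k, ‖a k‖ * r ^ k ≤ C * (1 / 2) ^ k := fun k ↦ by
    calc ‖a k‖ * r ^ k ≤ C * ρ ^ k * r ^ k := by gcongr; exact ha k
      _ = C * (ρ * r) ^ k := by ring
      _ ≤ _ := by gcongr
  have hs0 : Summable fun k ↦ ‖v k‖ * r ^ k :=
    .of_nonneg_of_le (fun k ↦ by positivity) hle (summable_geometric_two.mul_left M)
  have hsa : Summable fun k ↦ ‖a k‖ * r ^ k :=
    .of_nonneg_of_le (fun k ↦ by positivity) hle' (summable_geometric_two.mul_left C)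
  have hs1 : Summable fun k : ℕ ↦ ‖(k : ℂ) * v k‖ * r ^ k := by
    have h1 := (summable_pow_mul_geometric_of_norm_lt_one 1 (r := (1 / 2 : ℝ)) (by norm_num)).mul_left M
    refine .of_nonneg_of_le (fun k ↦ by positivity) (fun k ↦ ?_) h1
    rw [norm_mul, norm_natCast, mul_assoc]
    calc (k : ℝ) * (‖v k‖ * r ^ k) ≤ k * (M * (1 / 2) ^ k) :=
          mul_le_mul_of_nonneg_left (hle k) (by positivity)
      _ = _ := by ring
  obtain ⟨hd0, hS0⟩ := hasSum_theta hs0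
  obtain ⟨hd1, hS1⟩ := hasSum_theta hs1
  set u : ℂ → ℂ := fun z ↦ ∑' k, v k * z ^ k with hu
  have hball : Metric.ball (0 : ℂ) r ∈ 𝓝 0 := Metric.ball_mem_nhds _ hr0
  have hu0 : u 0 = u₀ := by
    have := (hS0 0 (Metric.mem_ball_self hr0)).1.unique (hasSum_single 0 fun k hk ↦ by simp [hk])
    simpa [hv, frobeniusCoeff_zero] using this
  have hθ : ∀ z ∈ Metric.ball (0 : ℂ) r, z * deriv u z = ∑' k : ℕ, (k * v k) * z ^ k :=
    fun z hz ↦ (hS0 z hz).2.tsum_eq.symm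
  have hdu : DifferentiableOn ℂ (deriv u) (Metric.ball 0 r) := hd0.deriv Metric.isOpen_ball
  have hθ2 : ∀ z ∈ Metric.ball (0 : ℂ) r,
      deriv (fun z ↦ ∑' k : ℕ, (k * v k) * z ^ k) z = deriv u z + z * deriv (deriv u) z := by
    intro z hz
    have h1 : (fun z ↦ ∑' k : ℕ, (k * v k) * z ^ k) =ᶠ[𝓝 z] fun z ↦ z * deriv u z := by
      filter_upwards [Metric.isOpen_ball.mem_nhds hz] with x hx using (hθ x hx).symm
    rw [h1.deriv_eq]
    have h2 := (hasDerivAt_id z).mul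
      (hdu.differentiableAt (Metric.isOpen_ball.mem_nhds hz)).hasDerivAt
    exact h2.deriv.trans (by simp)
  have hu1 : deriv u 0 = u₁ := by
    have h1 := hθ2 0 (Metric.mem_ball_self hr0)
    rw [zero_mul, add_zero] at h1
    rw [← h1]
    have hb' : ∀ (k : ℕ) (z : ℂ), z ∈ Metric.ball (0 : ℂ) r →
        ‖(k * v k) * z ^ k‖ ≤ ‖(k : ℂ) * v k‖ * r ^ k := by
      intro k z hz
      rw [norm_mul, norm_pow]
      gcongr
      exact (mem_ball_zero_iff.1 hz).le
    have h2 := hasSum_deriv_of_summable_norm hs1 (F := fun (k : ℕ) z ↦ (k * v k) * z ^ k)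
      (fun k ↦ by fun_prop) Metric.isOpen_ball hb' (Metric.mem_ball_self hr0)
    refine h2.unique ?_
    convert hasSum_single 1 fun k hk ↦ ?_ using 1
    · simp [hv, frobeniusCoeff_one]
    · rcases k with _ | _ | k
      · simp
      · simp at hk
      · simp
  refine ⟨u, hd0.analyticAt hball, hu0, hu1, ?_⟩
  filter_upwards [hball, hsum] with z hz hqz
  have hnorm : ∀ {w : ℕ → ℂ}, Summable (fun k ↦ ‖w k‖ * r ^ k) → Summable fun k ↦ ‖w k * z ^ k‖ := by
    intro w hw
    refine .of_nonneg_of_le (fun k ↦ norm_nonneg _) (fun k ↦ ?_) hw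
    rw [norm_mul, norm_pow]
    gcongr
    exact (mem_ball_zero_iff.1 hz).le
  -- The Cauchy product involves all of `q`. Its top term `a 0 * v k` matches the last summand of
  -- `hlhs`, which is why `q z - q 0` remains.
  have hprod := hasSum_sum_range_mul_of_summable_norm (hnorm hs0) (hnorm hsa)
  rw [hqz.tsum_eq] at hprod
  have hlhs := ((hS1 z hz).2.add ((hS0 z hz).2.mul_left b)).add ((hS0 z hz).1.mul_left (a 0))
  have heq := hlhs.unique (hprod.congr_fun fun k ↦ ?_)
  · rw [hθ2 z hz, ha0] at heq
    linear_combination heq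
  · rw [Finset.sum_range_succ]
    have h3 : ∀ j ∈ Finset.range k, v j * z ^ j * (a (k - j) * z ^ (k - j)) =
        a (k - j) * v j * z ^ k := by
      intro j hj
      have : z ^ k = z ^ j * z ^ (k - j) := by
        rw [← pow_add]; congr 1; have := Finset.mem_range.1 hj; omega
      rw [this]; ring
    rw [Finset.sum_congr rfl h3, ← Finset.sum_mul, ← hrec, Nat.sub_self]
    ring

lemma frobenius {q : ℂ → ℂ} {c : ℂ} (hq : AnalyticAt ℂ q c) {b u₀ u₁ : ℂ}
    (hb : ∀ k : ℕ, 2 ≤ k → 1 ≤ ‖(k : ℂ) + b‖) (h₁ : (1 + b) * u₁ = deriv q c * u₀) :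
    ∃ u : ℂ → ℂ, AnalyticAt ℂ u c ∧ u c = u₀ ∧ deriv u c = u₁ ∧ ∀ᶠ z in 𝓝 c,
      (z - c) ^ 2 * deriv (deriv u) z + (b + 1) * (z - c) * deriv u z = (q z - q c) * u z := by
  have hq0 : AnalyticAt ℂ (fun z ↦ q (z + c)) 0 :=
    AnalyticAt.comp_of_eq (g := q) hq (by fun_prop) (by simp)
  have hdq : deriv (fun z ↦ q (z + c)) 0 = deriv q c := by
    simpa using deriv_comp_add_const (f := q) c 0
  obtain ⟨u, hu, hu0, hu1, hode⟩ := frobenius_at_zero hq0 hb (by rw [hdq]; exact h₁)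
  have hd : deriv (fun z ↦ u (z - c)) = fun z ↦ deriv u (z - c) :=
    funext fun z ↦ deriv_comp_sub_const (f := u) c z
  refine ⟨fun z ↦ u (z - c), AnalyticAt.comp_of_eq (g := u) hu (by fun_prop) (by simp), by simpa,
    by simp [hd, hu1], ?_⟩
  have ht : Tendsto (fun z : ℂ ↦ z - c) (𝓝 c) (𝓝 0) := by
    have : Continuous fun z : ℂ ↦ z - c := by fun_prop
    simpa using this.tendsto c
  filter_upwards [ht.eventually hode] with z hz
  have hdd : deriv (fun z ↦ deriv u (z - c)) z = deriv (deriv u) (z - c) :=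
    deriv_comp_sub_const (f := deriv u) c z
  rw [hd, hdd]
  simpa using hz

/-! ### The transformed equation and its local solutions -/

/-- The defect of `y` in the equation `y'' - 2 P y' + (P² - P' - Q) y = 0`, which is obtained from
`w'' = Q w` by the substitution `y = w E`, where `E' = P E`. -/
def odeDefect (P Q y : ℂ → ℂ) (z : ℂ) : ℂ :=
  deriv (deriv y) z - 2 * P z * deriv y z + (P z ^ 2 - deriv P z - Q z) * y z

/-- `y` is holomorphic at `c` and satisfies the transformed equation in a punctured
neighbourhood of `c`. -/
def LocSol (P Q y : ℂ → ℂ) (c : ℂ) : Prop :=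
  AnalyticAt ℂ y c ∧ ∀ᶠ z in 𝓝[≠] c, odeDefect P Q y z = 0

/-- At `c` the equation `w'' = Q w` has a regular singularity with exponents `-n`, `n + 1`, and
`P` has at most a simple pole with residue `n`. -/
structure LocData (P Q : ℂ → ℂ) (c n : ℂ) : Prop where
  left : ∃ g : ℂ → ℂ, AnalyticAt ℂ g c ∧ ∀ᶠ z in 𝓝[≠] c, P z = n / (z - c) + g z
  right : ∃ q : ℂ → ℂ, AnalyticAt ℂ q c ∧ q c = n * (n + 1) ∧
    ∀ᶠ z in 𝓝[≠] c, (z - c) ^ 2 * Q z = q z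

/-- The operator is `(d/dz - P)² - Q`, and `(d/dz - P)(w E) = w' E` because `E' = P E`. -/
lemma odeDefect_of_mul {P Q w E y : ℂ → ℂ} {z : ℂ} (hP : DifferentiableAt ℂ P z)
    (hw : ∀ᶠ x in 𝓝 z, DifferentiableAt ℂ w x) (hw' : DifferentiableAt ℂ (deriv w) z)
    (hE : ∀ᶠ x in 𝓝 z, HasDerivAt E (P x * E x) x) (hy : y =ᶠ[𝓝 z] fun x ↦ w x * E x) :
    odeDefect P Q y z = (deriv (deriv w) z - Q z * w z) * E z := by
  have h1 : deriv y =ᶠ[𝓝 z] fun x ↦ (deriv w x + w x * P x) * E x := by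
    refine hy.deriv.trans ?_
    filter_upwards [hw, hE] with x hx hEx
    exact (hx.hasDerivAt.mul hEx).deriv.trans (by ring)
  have h2 : deriv (deriv y) z = _ := h1.deriv_eq.trans
    ((hw'.hasDerivAt.add (hw.self_of_nhds.hasDerivAt.mul hP.hasDerivAt)).mul
      hE.self_of_nhds).deriv
  rw [odeDefect, h2, h1.self_of_nhds, hy.self_of_nhds]
  simp only [Pi.add_apply, Pi.mul_apply]
  ring

lemma eventually_punctured_nhds {c : ℂ} {p : ℂ → Prop} (h : ∀ᶠ z in 𝓝[≠] c, p z) :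
    ∀ᶠ z in 𝓝[≠] c, ∀ᶠ x in 𝓝 z, p x := by
  have h1 := eventually_eventually_nhdsWithin.2 h
  filter_upwards [h1, self_mem_nhdsWithin] with z hz hzc
  rwa [isOpen_compl_singleton.nhdsWithin_eq hzc] at hz

/-- The factor `(z - c)²` clears the poles. `B c = n² + n - n (n + 1) = 0` and `A c = n` encode the
indicial polynomial `k (k - 1 - 2 n)`. -/
lemma LocData.exists_coeff {P Q : ℂ → ℂ} {c n : ℂ} (h : LocData P Q c n) :
    ∃ A B : ℂ → ℂ, AnalyticAt ℂ A c ∧ AnalyticAt ℂ B c ∧ A c = n ∧ B c = 0 ∧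
      ∀ᶠ z in 𝓝[≠] c, ∀ y : ℂ → ℂ, (z - c) ^ 2 * odeDefect P Q y z =
        (z - c) ^ 2 * deriv (deriv y) z - 2 * A z * ((z - c) * deriv y z) + B z * y z := by
  obtain ⟨g, hg, hPg⟩ := h.left
  obtain ⟨q, hq, hqc, hQq⟩ := h.right
  refine ⟨fun z ↦ n + (z - c) * g z,
    fun z ↦ (n + (z - c) * g z) ^ 2 + n - (z - c) ^ 2 * deriv g z - q z, by fun_prop, ?_,
    by simp, by simp [hqc]; ring, ?_⟩
  · have := hg.deriv
    fun_prop
  have hg' : ∀ᶠ z in 𝓝[≠] c, AnalyticAt ℂ g z := nhdsWithin_le_nhds hg.eventually_analyticAt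
  filter_upwards [eventually_punctured_nhds hPg, hQq, self_mem_nhdsWithin, hg'] with z h1 h2 hz h3 y
  have hz0 : z - c ≠ 0 := sub_ne_zero.2 hz
  have hdP : deriv P z = -n / (z - c) ^ 2 + deriv g z := by
    rw [EventuallyEq.deriv_eq h1]
    have h4 : HasDerivAt (fun z : ℂ ↦ z - c) 1 z := (hasDerivAt_id z).sub_const c
    have h5 := ((hasDerivAt_const z n).div h4 hz0).add h3.differentiableAt.hasDerivAt
    exact h5.deriv.trans (by simp)
  rw [odeDefect, hdP, Eventually.self_of_nhds h1, ← h2]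
  field_simp
  ring

/-- The identity theorem applies to the equation cleared of poles. This passes from a slit disc to a
full punctured neighbourhood. -/
lemma LocData.locSol_of_frequently {P Q : ℂ → ℂ} {c n : ℂ} (h : LocData P Q c n) {y : ℂ → ℂ}
    (hy : AnalyticAt ℂ y c) (hf : ∃ᶠ z in 𝓝[≠] c, odeDefect P Q y z = 0) : LocSol P Q y c := by
  obtain ⟨A, B, hA, hB, -, -, hAB⟩ := h.exists_coeff
  have h1 : AnalyticAt ℂ (fun z ↦
      (z - c) ^ 2 * deriv (deriv y) z - 2 * A z * ((z - c) * deriv y z) + B z * y z) c := by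
    have h2 := hy.deriv
    have h3 := h2.deriv
    fun_prop
  have h2 : ∃ᶠ z in 𝓝[≠] c,
      (z - c) ^ 2 * deriv (deriv y) z - 2 * A z * ((z - c) * deriv y z) + B z * y z = 0 := by
    refine (hf.and_eventually hAB).mono fun z hz ↦ ?_
    rw [← hz.2 y, hz.1, mul_zero]
  have h3 := nhdsWithin_le_nhds (s := {c}ᶜ) (h1.frequently_zero_iff_eventually_zero.1 h2)
  refine ⟨hy, ?_⟩
  filter_upwards [h3, hAB, self_mem_nhdsWithin] with z hz h4 hzc
  rw [← h4 y] at hz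
  exact (mul_eq_zero.1 hz).resolve_left (pow_ne_zero 2 (sub_ne_zero.2 hzc))

/-- There are two linearly independent germs of solutions at `c`. -/
def HasLocalBasis (P Q : ℂ → ℂ) (c : ℂ) : Prop :=
  ∃ y₁ y₂ : ℂ → ℂ, LocSol P Q y₁ c ∧ LocSol P Q y₂ c ∧
    ∀ α β : ℂ, (∀ᶠ z in 𝓝 c, α * y₁ z + β * y₂ z = 0) → α = 0 ∧ β = 0

lemma exists_primitive_near {g : ℂ → ℂ} {c : ℂ} (hg : AnalyticAt ℂ g c) :
    ∃ G : ℂ → ℂ, ∀ᶠ z in 𝓝 c, HasDerivAt G (g z) z := by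
  obtain ⟨ε, hε, hb⟩ := Metric.eventually_nhds_iff_ball.1 hg.eventually_analyticAt
  obtain ⟨G, hG⟩ := DifferentiableOn.isExactOn_ball (f := g) (c := c) (r := ε)
    fun z hz ↦ (hb z hz).differentiableAt.differentiableWithinAt
  exact ⟨G, by filter_upwards [Metric.ball_mem_nhds c hε] with z hz using hG z hz⟩

lemma analyticAt_of_eventually_hasDerivAt {G g : ℂ → ℂ} {c : ℂ}
    (h : ∀ᶠ z in 𝓝 c, HasDerivAt G (g z) z) : AnalyticAt ℂ G c :=
  analyticAt_iff_eventually_differentiableAt.2 (h.mono fun _ hz ↦ hz.differentiableAt)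

/-- `w'' = Q w` is the Frobenius equation with `b = -1` and `q = (z - c)² Q`. As `q` and `q'` vanish
at `c`, both initial values are free; `exp G`, with `G' = P`, passes from `w` to `y`. -/
lemma hasLocalBasis_of_analyticAt {P Q : ℂ → ℂ} {c : ℂ} (hP : AnalyticAt ℂ P c)
    (hQ : AnalyticAt ℂ Q c) : HasLocalBasis P Q c := by
  obtain ⟨G, hG⟩ := exists_primitive_near hP
  have hGa := analyticAt_of_eventually_hasDerivAt hG
  have hqd : HasDerivAt (fun z ↦ (z - c) ^ 2 * Q z) 0 c := by
    have h1 := (((hasDerivAt_id c).sub_const c).pow 2).mul hQ.differentiableAt.hasDerivAt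
    exact h1.congr_deriv (by simp)
  have key : ∀ u₀ u₁ : ℂ, ∃ w : ℂ → ℂ, AnalyticAt ℂ w c ∧ w c = u₀ ∧ deriv w c = u₁ ∧
      LocSol P Q (fun z ↦ w z * exp (G z)) c := by
    intro u₀ u₁
    obtain ⟨w, hw, hw0, hw1, hode⟩ := frobenius (q := fun z ↦ (z - c) ^ 2 * Q z) (c := c)
      (by fun_prop) (b := -1) (u₀ := u₀) (u₁ := u₁) (fun k hk ↦ by
        have : (k : ℂ) + -1 = ((k - 1 : ℕ) : ℂ) := by
          rw [Nat.cast_sub (by omega)]; push_cast; ring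
        rw [this, norm_natCast]
        exact_mod_cast (by omega : 1 ≤ k - 1)) (by simp [hqd.deriv])
    refine ⟨w, hw, hw0, hw1, hw.mul hGa.cexp, ?_⟩
    have hw' := hw.deriv
    have hPe := hP.eventually_analyticAt
    have hE : ∀ᶠ z in 𝓝 c, HasDerivAt (fun z ↦ exp (G z)) (P z * exp (G z)) z :=
      hG.mono fun z hz ↦ hz.cexp.congr_deriv (mul_comm _ _)
    filter_upwards [nhdsWithin_le_nhds hode, nhdsWithin_le_nhds hPe,
      nhdsWithin_le_nhds hE.eventually_nhds, nhdsWithin_le_nhds hw.eventually_analyticAt,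
      self_mem_nhdsWithin] with z h1 h2 h3 h4 hz
    rw [odeDefect_of_mul (w := w) h2.differentiableAt
      (h4.eventually_analyticAt.mono fun x hx ↦ hx.differentiableAt) h4.deriv.differentiableAt h3
      .rfl]
    have hz0 : (z - c) ^ 2 ≠ 0 := pow_ne_zero 2 (sub_ne_zero.2 hz)
    rw [mul_eq_zero]; left
    apply mul_left_cancel₀ hz0
    simp only [neg_add_cancel, zero_mul, add_zero, sub_self, ne_eq, OfNat.ofNat_ne_zero,
      not_false_eq_true, zero_pow, sub_zero] at h1
    linear_combination h1
  obtain ⟨w₁, ha1, hv1, hd1, hs1⟩ := key 1 0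
  obtain ⟨w₂, ha2, hv2, hd2, hs2⟩ := key 0 1
  refine ⟨_, _, hs1, hs2, fun α β h ↦ ?_⟩
  have h1 : (fun z ↦ α * w₁ z + β * w₂ z) =ᶠ[𝓝 c] fun _ ↦ 0 := by
    filter_upwards [h] with z hz
    have : (α * w₁ z + β * w₂ z) * exp (G z) = 0 := by linear_combination hz
    exact (mul_eq_zero.1 this).resolve_right (exp_ne_zero _)
  have h2 := h1.self_of_nhds
  have h3 := h1.deriv_eq
  have h4 := ((ha1.differentiableAt.hasDerivAt.const_mul α).add
    (ha2.differentiableAt.hasDerivAt.const_mul β)).deriv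
  have h5 : deriv (fun z ↦ α * w₁ z + β * w₂ z) c = _ := h4
  rw [h5, deriv_const] at h3
  simp [hv1, hv2] at h2
  simp [hd1, hd2] at h3
  exact ⟨h2, h3⟩

/-- Splitting `g = g(c) + (z - c) g₁` lowers the pole order by one. The pure power has an elementary
primitive, a logarithm when the exponent is `-1`; this is the only use of the slit. -/
lemma exists_primitive_slitDisc {c : ℂ} {ε : ℝ} (hε : 0 < ε) (k : ℕ) {g : ℂ → ℂ}
    (hg : DifferentiableOn ℂ g (Metric.ball c ε)) :
    ∃ F : ℂ → ℂ, ∀ z ∈ slitDisc c ε, HasDerivAt F (g z / (z - c) ^ k) z := by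
  induction k generalizing g with
  | zero =>
    obtain ⟨F, hF⟩ := hg.isExactOn_ball
    exact ⟨F, fun z hz ↦ by simpa using hF z hz.1⟩
  | succ k ih =>
    have hg' : DifferentiableOn ℂ (dslope g c) (Metric.ball c ε) :=
      (differentiableOn_dslope (Metric.ball_mem_nhds c hε)).2 hg
    obtain ⟨F, hF⟩ := ih hg'
    obtain ⟨H, hH⟩ : ∃ H : ℂ → ℂ, ∀ z ∈ slitDisc c ε, HasDerivAt H (1 / (z - c) ^ (k + 1)) z := by
      rcases Nat.eq_zero_or_pos k with rfl | hk
      · refine ⟨fun z ↦ log (z - c), fun z hz ↦ ?_⟩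
        simpa using ((hasDerivAt_id z).sub_const c).clog hz.2
      · refine ⟨fun z ↦ -(1 / k) * ((z - c) ^ k)⁻¹, fun z hz ↦ ?_⟩
        have h0 : z - c ≠ 0 := slitPlane_ne_zero hz.2
        have hk' : (k : ℂ) ≠ 0 := by exact_mod_cast hk.ne'
        have h1 := ((((hasDerivAt_id z).sub_const c).pow k).inv (pow_ne_zero k h0)).const_mul
          (-(1 / (k : ℂ)))
        refine h1.congr_deriv ?_
        obtain ⟨j, rfl⟩ : ∃ j, k = j + 1 := ⟨k - 1, by omega⟩
        simp only [id, Nat.add_sub_cancel, Pi.pow_apply]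
        field_simp
        ring
    refine ⟨fun z ↦ g c * H z + F z, fun z hz ↦ ?_⟩
    refine (((hH z hz).const_mul (g c)).add (hF z hz)).congr_deriv ?_
    have h0 : z - c ≠ 0 := slitPlane_ne_zero hz.2
    rw [dslope_of_ne _ (sub_ne_zero.1 h0), slope_def_field]
    field_simp
    ring

lemma isOpen_slitDisc (c : ℂ) (ε : ℝ) : IsOpen (slitDisc c ε) :=
  Metric.isOpen_ball.inter (isOpen_slitPlane.preimage (by fun_prop))

lemma frequently_sub_mem_slitPlane (c : ℂ) : ∃ᶠ z in 𝓝[≠] c, z - c ∈ slitPlane := by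
  rw [frequently_nhdsWithin_iff, Metric.nhds_basis_ball.frequently_iff]
  intro ε hε
  refine ⟨c + (ε / 2 : ℝ), ?_, ?_, ?_⟩
  · rw [Metric.mem_ball, dist_self_add_left, norm_real, Real.norm_of_nonneg (by positivity)]
    linarith
  · rw [add_sub_cancel_left, ofReal_mem_slitPlane]; positivity
  · simp [hε.ne']

lemma isSolutionOn_of_hasDerivAt {Q w d : ℂ → ℂ} {S : Set ℂ} (hS : IsOpen S)
    (h₁ : ∀ z ∈ S, HasDerivAt w (d z) z) (h₂ : ∀ z ∈ S, HasDerivAt d (Q z * w z) z) :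
    IsSolutionOn Q S w := by
  refine ⟨fun z hz ↦ (h₁ z hz).differentiableAt.differentiableWithinAt, fun z hz ↦ ?_⟩
  have : deriv w =ᶠ[𝓝 z] d := by
    filter_upwards [hS.mem_nhds hz] with x hx using (h₁ x hx).deriv
  rw [this.deriv_eq, (h₂ z hz).deriv]

lemma odeDefect_eq_zero {P Q w E y : ℂ → ℂ} {S : Set ℂ} (hS : IsOpen S)
    (hw : IsSolutionOn Q S w) {z : ℂ} (hz : z ∈ S) (hP : DifferentiableAt ℂ P z)
    (hE : ∀ᶠ x in 𝓝 z, HasDerivAt E (P x * E x) x) (hy : y =ᶠ[𝓝 z] fun x ↦ w x * E x) :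
    odeDefect P Q y z = 0 := by
  rw [odeDefect_of_mul hP (by
    filter_upwards [hS.mem_nhds hz] with x hx using hw.1.differentiableAt (hS.mem_nhds hx))
    ((hw.1.deriv hS).differentiableAt (hS.mem_nhds hz)) hE hy, hw.2 z hz, sub_self, zero_mul]

/-- The larger exponent always gives a Frobenius solution `w₁ = (z - c)^(n+1) u`, since `b = 2 n + 1
= m + 1` causes no resonance. Reduction of order gives a second one on the slit disc, `w₂ = w₁ ∫
w₁⁻²`, and log-freeness is applied to it. Multiplication by `E = (z - c)^n exp G` turns the powers
`(z - c)^(-n)` and `(z - c)^(n+1)` into `1` and `(z - c)^(m+1)`, so both products extend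
holomorphically to `c`. -/
lemma hasLocalBasis_of_logFree {P Q : ℂ → ℂ} {c n : ℂ} {m : ℕ} (hn : n = m / 2)
    (hD : LocData P Q c n) (hlog : LogFreeAt Q c n) : HasLocalBasis P Q c := by
  obtain ⟨g, hg, hPg⟩ := hD.left
  obtain ⟨q, hq, hqc, hQq⟩ := hD.right
  obtain ⟨G, hG⟩ := exists_primitive_near hg
  have hGa := analyticAt_of_eventually_hasDerivAt hG
  have hm1 : (1 : ℂ) + (m + 1) ≠ 0 := by exact_mod_cast (by omega : 1 + (m + 1) ≠ 0)
  obtain ⟨u, hu, hu0, -, hode⟩ := frobenius hq (b := m + 1) (u₀ := 1)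
    (u₁ := deriv q c / (1 + (m + 1))) (fun k hk ↦ by
      rw [show (k : ℂ) + (m + 1) = ((k + (m + 1) : ℕ) : ℂ) by push_cast; ring, norm_natCast]
      exact_mod_cast (by omega : 1 ≤ k + (m + 1))) (by field_simp)
  have hune : ∀ᶠ z in 𝓝 c, u z ≠ 0 := hu.continuousAt.eventually_ne (by simp [hu0])
  have hgood : ∀ᶠ z in 𝓝 c, HasDerivAt G (g z) z ∧ AnalyticAt ℂ u z ∧ u z ≠ 0 ∧
      (z - c) ^ 2 * deriv (deriv u) z + (m + 1 + 1) * (z - c) * deriv u z = (q z - q c) * u z ∧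
      (z ≠ c → (∀ᶠ x in 𝓝 z, P x = n / (x - c) + g x) ∧ AnalyticAt ℂ g z ∧
        (z - c) ^ 2 * Q z = q z) := by
    filter_upwards [hG, hu.eventually_analyticAt, hune, hode, hg.eventually_analyticAt,
      eventually_nhdsWithin_iff.1 (eventually_punctured_nhds hPg),
      eventually_nhdsWithin_iff.1 hQq] with z h1 h2 h3 h4 h5 h6 h7
    exact ⟨h1, h2, h3, h4, fun hz ↦ ⟨h6 hz, h5, h7 hz⟩⟩
  obtain ⟨ε, hε, hb⟩ := Metric.eventually_nhds_iff_ball.1 hgood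
  set S := slitDisc c ε with hSdef
  have hS : IsOpen S := isOpen_slitDisc c ε
  have hne : ∀ z ∈ S, z - c ≠ 0 := fun z hz ↦ slitPlane_ne_zero hz.2
  have hne' : ∀ z ∈ S, z ≠ c := fun z hz ↦ sub_ne_zero.1 (hne z hz)
  set t : ℂ → ℂ := fun z ↦ (z - c) ^ n with ht
  have ht0 : ∀ z ∈ S, t z ≠ 0 := fun z hz ↦ by simp [ht, cpow_eq_zero_iff, hne z hz]
  have htd : ∀ z ∈ S, HasDerivAt t (n * t z / (z - c)) z := fun z hz ↦ by
    have h1 := ((hasDerivAt_id z).sub_const c).cpow_const (c := n) hz.2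
    refine h1.congr_deriv ?_
    simp only [id, mul_one, ht]
    rw [cpow_sub _ _ (hne z hz), cpow_one]
    ring
  have ht2 : ∀ z ∈ S, t z * t z = (z - c) ^ m := fun z hz ↦ by
    simp only [ht]
    rw [← cpow_add _ _ (hne z hz), hn, add_halves, cpow_natCast]
  have htneg : ∀ z ∈ S, t z * (z - c) ^ (-n) = 1 := fun z hz ↦ by
    rw [cpow_neg]; exact mul_inv_cancel₀ (ht0 z hz)
  have htsucc : ∀ z ∈ S, (z - c) ^ (n + 1) = t z * (z - c) := fun z hz ↦ by
    rw [cpow_add _ _ (hne z hz), cpow_one]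
  set E : ℂ → ℂ := fun z ↦ t z * exp (G z) with hEdef
  have hE0 : ∀ z ∈ S, E z ≠ 0 := fun z hz ↦ mul_ne_zero (ht0 z hz) (exp_ne_zero _)
  have hE : ∀ z ∈ S, HasDerivAt E (P z * E z) z := fun z hz ↦ by
    obtain ⟨h1, -, -, -, h5⟩ := hb z hz.1
    refine ((htd z hz).mul h1.cexp).congr_deriv ?_
    rw [Eventually.self_of_nhds (h5 (hne' z hz)).1]
    simp only [hEdef]
    ring
  have hPd : ∀ z ∈ S, DifferentiableAt ℂ P z := fun z hz ↦ by
    obtain ⟨-, -, -, -, h5⟩ := hb z hz.1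
    obtain ⟨h6, h7, -⟩ := h5 (hne' z hz)
    refine DifferentiableAt.congr_of_eventuallyEq ?_ h6
    have := h7.differentiableAt
    have h8 := hne z hz
    fun_prop (disch := assumption)
  set w₁ : ℂ → ℂ := fun z ↦ t z * ((z - c) * u z) with hw₁
  set d₁ : ℂ → ℂ := fun z ↦ t z * ((n + 1) * u z + (z - c) * deriv u z) with hd₁
  have hw₁0 : ∀ z ∈ S, w₁ z ≠ 0 := fun z hz ↦
    mul_ne_zero (ht0 z hz) (mul_ne_zero (hne z hz) (hb z hz.1).2.2.1)
  have hw₁d : ∀ z ∈ S, HasDerivAt w₁ (d₁ z) z := fun z hz ↦ by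
    have h1 := (hb z hz.1).2.1.differentiableAt.hasDerivAt
    refine ((htd z hz).mul (((hasDerivAt_id z).sub_const c).mul h1)).congr_deriv ?_
    have := hne z hz
    simp only [hd₁, id, Pi.mul_apply]
    field_simp
    ring
  have hd₁d : ∀ z ∈ S, HasDerivAt d₁ (Q z * w₁ z) z := fun z hz ↦ by
    obtain ⟨-, h2, -, h4, h5⟩ := hb z hz.1
    have h6 := (h5 (hne' z hz)).2.2
    have h1 := h2.differentiableAt.hasDerivAt
    have h1' := h2.deriv.differentiableAt.hasDerivAt
    refine ((htd z hz).mul ((h1.const_mul (n + 1)).add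
      (((hasDerivAt_id z).sub_const c).mul h1'))).congr_deriv ?_
    have h0 := hne z hz
    simp only [hw₁, id, Pi.mul_apply, Pi.add_apply]
    have h7 : Q z = q z / (z - c) ^ 2 := by rw [← h6]; field_simp
    have hmn : (m : ℂ) = 2 * n := by rw [hn]; ring
    rw [hmn] at h4
    rw [hqc] at h4
    rw [h7]
    field_simp
    linear_combination t z * h4
  have hw₁s := isSolutionOn_of_hasDerivAt hS hw₁d hd₁d
  -- `w₁⁻² = (z - c)^(-(m+2)) u⁻²` has an integral exponent because `2 n = m`.
  obtain ⟨F, hF⟩ := exists_primitive_slitDisc hε (m + 2) (c := c) (g := fun z ↦ 1 / u z ^ 2)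
    (fun z hz ↦ by
      have h1 := (hb z hz).2.1.differentiableAt
      have h2 := pow_ne_zero 2 (hb z hz).2.2.1
      refine DifferentiableAt.differentiableWithinAt ?_
      fun_prop (disch := assumption))
  have hF' : ∀ z ∈ S, HasDerivAt F (1 / w₁ z ^ 2) z := fun z hz ↦ by
    refine (hF z hz).congr_deriv ?_
    have h1 := (hb z hz.1).2.2.1
    have h2 := hne z hz
    simp only [hw₁]
    rw [show (t z * ((z - c) * u z)) ^ 2 = (t z * t z) * ((z - c) * u z) ^ 2 by ring, ht2 z hz]
    field_simp
    ring
  have hw₂s : IsSolutionOn Q S fun z ↦ w₁ z * F z := by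
    refine isSolutionOn_of_hasDerivAt hS (d := fun z ↦ d₁ z * F z + (w₁ z)⁻¹) (fun z hz ↦ ?_)
      fun z hz ↦ ?_
    · refine ((hw₁d z hz).mul (hF' z hz)).congr_deriv ?_
      have := hw₁0 z hz
      field_simp
    · refine (((hd₁d z hz).mul (hF' z hz)).add ((hw₁d z hz).inv (hw₁0 z hz))).congr_deriv ?_
      have := hw₁0 z hz
      field_simp
      ring
  obtain ⟨h₁, h₂, hh₁, hh₂, hform⟩ := hlog ε hε _ hw₂s
  have hnear : ∀ᶠ z in 𝓝 c, z - c ∈ slitPlane → z ∈ S := by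
    filter_upwards [Metric.ball_mem_nhds c hε] with z hz hzs using ⟨hz, hzs⟩
  have hfreq : ∀ {w y : ℂ → ℂ}, IsSolutionOn Q S w → AnalyticAt ℂ y c →
      (∀ᶠ z in 𝓝 c, z - c ∈ slitPlane → y z = w z * E z) → LocSol P Q y c := by
    intro w y hw hya hy
    refine hD.locSol_of_frequently hya ?_
    refine ((frequently_sub_mem_slitPlane c).and_eventually
      (nhdsWithin_le_nhds (hnear.and hy.eventually_nhds))).mono fun z hz ↦ ?_
    have hzS := hz.2.1 hz.1
    refine odeDefect_eq_zero hS hw hzS (hPd z hzS)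
      (by filter_upwards [hS.mem_nhds hzS] with x hx using hE x hx) ?_
    filter_upwards [hz.2.2, hS.mem_nhds hzS] with x hx hxS using hx hxS.2
  set y₁ : ℂ → ℂ := fun z ↦ (z - c) ^ (m + 1) * u z * exp (G z) with hy₁
  set y₂ : ℂ → ℂ := fun z ↦ (h₁ z + (z - c) ^ (m + 1) * h₂ z) * exp (G z) with hy₂
  have hy₁E : ∀ᶠ z in 𝓝 c, z - c ∈ slitPlane → y₁ z = w₁ z * E z := by
    filter_upwards [hnear] with z hz hzs
    simp only [hy₁, hw₁, hEdef]
    rw [pow_succ, ← ht2 z (hz hzs)]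
    ring
  have hy₂E : ∀ᶠ z in 𝓝 c, z - c ∈ slitPlane → y₂ z = w₁ z * F z * E z := by
    filter_upwards [hnear, hform] with z hz hz2 hzs
    rw [hz2 hzs, htsucc z (hz hzs)]
    simp only [hy₂, hEdef]
    rw [pow_succ, ← ht2 z (hz hzs)]
    linear_combination (-h₁ z * exp (G z)) * htneg z (hz hzs)
  refine ⟨y₁, y₂, hfreq hw₁s (by have := hGa.cexp; fun_prop) hy₁E,
    hfreq hw₂s (by have := hGa.cexp; fun_prop) hy₂E, fun α β hαβ ↦ ?_⟩
  obtain ⟨z, hzs, hz⟩ := ((frequently_sub_mem_slitPlane c).and_eventually (nhdsWithin_le_nhds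
    (hnear.and (hαβ.and (hy₁E.and hy₂E)).eventually_nhds))).exists
  have hzS := hz.1 hzs
  -- Dividing the relation by `w₁ E` leaves `α + β F = 0`. Differentiation gives `β = 0`, as `F' =
  -- w₁⁻²` has no zeros.
  have hlin : (fun x ↦ α + β * F x) =ᶠ[𝓝 z] fun _ ↦ 0 := by
    filter_upwards [hz.2, hS.mem_nhds hzS] with x hx hxS
    obtain ⟨e1, e2, e3⟩ := hx
    rw [e2 hxS.2, e3 hxS.2] at e1
    have : (α + β * F x) * (w₁ x * E x) = 0 := by linear_combination e1
    exact (mul_eq_zero.1 this).resolve_right (mul_ne_zero (hw₁0 x hxS) (hE0 x hxS))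
  have h3 := hlin.deriv_eq
  rw [((((hF' z hzS).const_mul β)).const_add α).deriv, deriv_const] at h3
  have hβ : β = 0 := (mul_eq_zero.1 h3).resolve_right (by simp [hw₁0 z hzS])
  have h4 := hlin.self_of_nhds
  simp only [hβ, zero_mul, add_zero] at h4
  exact ⟨h4, hβ⟩

/-- Substitute `y = (z - c)^k v` with `v c ≠ 0`, cancel `(z - c)^k` and evaluate at `c`: what
remains is the indicial equation. -/
lemma LocSol.analyticOrderAt {P Q y : ℂ → ℂ} {c n : ℂ} (hD : LocData P Q c n)
    (hy : LocSol P Q y c) (h0 : ¬ ∀ᶠ z in 𝓝 c, y z = 0) :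
    ∃ k : ℕ, analyticOrderAt y c = k ∧ (k : ℂ) * (k - 1 - 2 * n) = 0 := by
  obtain ⟨A, B, hA, hB, hAc, hBc, hAB⟩ := hD.exists_coeff
  obtain ⟨k, hk⟩ := ENat.ne_top_iff_exists.1 (mt analyticOrderAt_eq_top.1 h0)
  obtain ⟨v, hv, hvc, hyv⟩ := hy.1.analyticOrderAt_eq_natCast.1 hk.symm
  refine ⟨k, hk.symm, ?_⟩
  have hv' := hv.deriv
  have hv'' := hv'.deriv
  set b : ℂ → ℂ := fun z ↦ k * (k - 1) * v z + 2 * k * (z - c) * deriv v z +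
    (z - c) ^ 2 * deriv (deriv v) z - 2 * A z * (k * v z + (z - c) * deriv v z) + B z * v z with hb
  have hba : AnalyticAt ℂ b c := by fun_prop
  have hbz : ∀ᶠ z in 𝓝[≠] c, b z = 0 := by
    filter_upwards [hy.2, hAB, nhdsWithin_le_nhds hyv.eventually_nhds,
      nhdsWithin_le_nhds hv.eventually_analyticAt, self_mem_nhdsWithin] with z h1 h2 h3 h4 hz
    have hs : ∀ {x}, x ≠ c → x - c ≠ 0 := fun hx ↦ sub_ne_zero.2 hx
    have hpow : ∀ {x}, x ≠ c → HasDerivAt (fun x ↦ (x - c) ^ k) (k * (x - c) ^ k / (x - c)) x := by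
      intro x hx
      have h5 := ((hasDerivAt_id x).sub_const c).pow k
      refine h5.congr_deriv ?_
      have := hs hx
      rcases k with _ | k
      · simp
      · simp only [id, Nat.add_sub_cancel, mul_one]; field_simp; ring
    have hd1 : ∀ᶠ x in 𝓝 z, deriv y x = (x - c) ^ k * (k * v x / (x - c) + deriv v x) := by
      filter_upwards [Eventually.eventually_nhds h3, h4.eventually_analyticAt,
        isOpen_compl_singleton.mem_nhds hz] with x h6 h7 hx
      have h8 : HasDerivAt (fun x ↦ (x - c) ^ k • v x) _ x :=
        (hpow hx).mul h7.differentiableAt.hasDerivAt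
      rw [EventuallyEq.deriv_eq h6, h8.deriv]
      have := hs hx
      field_simp
    have hd2 := (hpow hz).mul (((h4.differentiableAt.hasDerivAt.const_mul (k : ℂ)).div
      ((hasDerivAt_id z).sub_const c) (hs hz)).add h4.deriv.differentiableAt.hasDerivAt)
    have h5 := h2 y
    have hd2' : deriv (deriv y) z = _ := (EventuallyEq.deriv_eq hd1).trans hd2.deriv
    rw [h1, mul_zero, hd2', hd1.self_of_nhds, Eventually.self_of_nhds h3] at h5
    have h6 := hs hz
    have h7 : (z - c) ^ k * b z = 0 := by
      rw [h5]
      simp only [hb, id, Pi.add_apply, Pi.div_apply, smul_eq_mul]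
      field_simp
      ring
    exact (mul_eq_zero.1 h7).resolve_left (pow_ne_zero k h6)
  have hbc : b c = 0 := (hba.frequently_zero_iff_eventually_zero.1 hbz.frequently).self_of_nhds
  simp only [hb, hAc, hBc, sub_self] at hbc
  have : (k * (k - 1 - 2 * n)) * v c = 0 := by linear_combination hbc
  exact (mul_eq_zero.1 this).resolve_right hvc

/-- Uniqueness for the Cauchy problem: for `n = 0` a nonzero solution has order `0` or `1`. -/
lemma LocSol.eventually_eq_zero {P Q y : ℂ → ℂ} {c : ℂ} (hD : LocData P Q c 0)
    (hy : LocSol P Q y c) (h0 : y c = 0) (h1 : deriv y c = 0) : ∀ᶠ z in 𝓝 c, y z = 0 := by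
  by_contra h
  obtain ⟨k, hk, hk'⟩ := hy.analyticOrderAt hD h
  have hk2 : k = 0 ∨ k = 1 := by
    rcases mul_eq_zero.1 hk' with h2 | h2
    · left; exact_mod_cast h2
    · right
      have : (k : ℂ) = 1 := by linear_combination h2
      exact_mod_cast this
  obtain ⟨v, hv, hvc, hyv⟩ := hy.1.analyticOrderAt_eq_natCast.1 hk
  rcases hk2 with rfl | rfl
  · have := hyv.self_of_nhds
    simp [h0, hvc.symm] at this
  · have h3 : HasDerivAt (fun z ↦ (z - c) ^ 1 • v z) (v c) c := by
      have := ((hasDerivAt_id c).sub_const c).mul hv.differentiableAt.hasDerivAt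
      simp only [pow_one, smul_eq_mul]
      exact this.congr_deriv (by simp)
    rw [EventuallyEq.deriv_eq hyv, h3.deriv] at h1
    exact hvc h1

lemma LocSol.congr {P Q y y' : ℂ → ℂ} {c : ℂ} (hy : LocSol P Q y c) (h : y =ᶠ[𝓝 c] y') :
    LocSol P Q y' c := by
  refine ⟨hy.1.congr h, ?_⟩
  filter_upwards [hy.2, nhdsWithin_le_nhds h.eventuallyEq_nhds] with z h1 h2
  have h3 : deriv (deriv y') z = deriv (deriv y) z := h2.symm.deriv.deriv_eq
  have h4 : deriv y' z = deriv y z := h2.symm.deriv_eq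
  rw [odeDefect, h3, h4, ← h2.self_of_nhds]
  exact h1

lemma LocSol.eventually {P Q y : ℂ → ℂ} {c : ℂ} (hy : LocSol P Q y c) :
    ∀ᶠ z in 𝓝 c, LocSol P Q y z := by
  rw [← nhdsNE_sup_pure, eventually_sup, eventually_pure]
  refine ⟨?_, hy⟩
  filter_upwards [nhdsWithin_le_nhds hy.1.eventually_analyticAt, eventually_punctured_nhds hy.2]
    with z h1 h2 using ⟨h1, nhdsWithin_le_nhds h2⟩

lemma LocSol.linear {P Q y₁ y₂ : ℂ → ℂ} {c : ℂ} (h₁ : LocSol P Q y₁ c) (h₂ : LocSol P Q y₂ c)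
    (α β : ℂ) : LocSol P Q (fun z ↦ α * y₁ z + β * y₂ z) c := by
  have ha : AnalyticAt ℂ (fun z ↦ α * y₁ z + β * y₂ z) c :=
    (analyticAt_const.mul h₁.1).add (analyticAt_const.mul h₂.1)
  refine ⟨ha, ?_⟩
  filter_upwards [h₁.2, h₂.2, nhdsWithin_le_nhds h₁.1.eventually_analyticAt,
    nhdsWithin_le_nhds h₂.1.eventually_analyticAt] with z e₁ e₂ a₁ a₂
  have d1 : ∀ᶠ x in 𝓝 z, deriv (fun z ↦ α * y₁ z + β * y₂ z) x =
      α * deriv y₁ x + β * deriv y₂ x := by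
    filter_upwards [a₁.eventually_analyticAt, a₂.eventually_analyticAt] with x b₁ b₂
    exact ((b₁.differentiableAt.hasDerivAt.const_mul α).add
      (b₂.differentiableAt.hasDerivAt.const_mul β)).deriv
  have d2 : deriv (deriv (fun z ↦ α * y₁ z + β * y₂ z)) z = _ := (EventuallyEq.deriv_eq d1).trans
    ((a₁.deriv.differentiableAt.hasDerivAt.const_mul α).add
      (a₂.deriv.differentiableAt.hasDerivAt.const_mul β)).deriv
  rw [odeDefect, d2, d1.self_of_nhds]
  unfold odeDefect at e₁ e₂
  linear_combination α * e₁ + β * e₂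

lemma eqOn_of_eventuallyEq {P Q f g : ℂ → ℂ} {U : Set ℂ} (hf : ∀ z ∈ U, LocSol P Q f z)
    (hg : ∀ z ∈ U, LocSol P Q g z) (hU : IsPreconnected U) {c : ℂ} (hc : c ∈ U)
    (h : f =ᶠ[𝓝 c] g) : Set.EqOn f g U :=
  AnalyticOnNhd.eqOn_of_preconnected_of_eventuallyEq (fun z hz ↦ (hf z hz).1)
    (fun z hz ↦ (hg z hz).1) hU hc h

/-! ### Analytic continuation to an entire solution -/

/-- Near every point the equation has a local basis of solutions, and its singular points are
isolated. -/
structure GoodEquation (P Q : ℂ → ℂ) : Prop where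
  basis : ∀ c, HasLocalBasis P Q c
  regular : ∀ c, ∀ᶠ z in 𝓝[≠] c, LocData P Q z 0

/-- On a ball carrying a local basis, every solution on a connected open piece is a combination of
the basis: value and derivative are matched at one regular point `z₀` of the piece. The combination
is defined on the whole ball. -/
lemma GoodEquation.local_extension {P Q : ℂ → ℂ} (H : GoodEquation P Q) (c : ℂ) :
    ∃ ε > 0, ∀ W : Set ℂ, IsOpen W → W ⊆ Metric.ball c ε → IsPreconnected W → W.Nonempty →
      ∀ y : ℂ → ℂ, (∀ z ∈ W, LocSol P Q y z) →
        ∃ y' : ℂ → ℂ, (∀ z ∈ Metric.ball c ε, LocSol P Q y' z) ∧ Set.EqOn y y' W := by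
  obtain ⟨y₁, y₂, h₁, h₂, hind⟩ := H.basis c
  obtain ⟨ε, hε, hb⟩ := Metric.eventually_nhds_iff_ball.1 (h₁.eventually.and h₂.eventually)
  refine ⟨ε, hε, fun W hW hWb hWc ⟨c₀, hc₀⟩ y hy ↦ ?_⟩
  obtain ⟨z₀, hz₀r, hz₀⟩ := ((H.regular c₀).and (nhdsWithin_le_nhds (hW.mem_nhds hc₀))).exists
  have hcomb : ∀ α β : ℂ, ∀ z ∈ Metric.ball c ε, LocSol P Q (fun z ↦ α * y₁ z + β * y₂ z) z :=
    fun α β z hz ↦ (hb z hz).1.linear (hb z hz).2 α β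
  have hder : ∀ α β : ℂ, deriv (fun z ↦ α * y₁ z + β * y₂ z) z₀ =
      α * deriv y₁ z₀ + β * deriv y₂ z₀ := fun α β ↦
    (((hb z₀ (hWb hz₀)).1.1.differentiableAt.hasDerivAt.const_mul α).add
      ((hb z₀ (hWb hz₀)).2.1.differentiableAt.hasDerivAt.const_mul β)).deriv
  have hzero : ∀ α β : ℂ, α * y₁ z₀ + β * y₂ z₀ = 0 → α * deriv y₁ z₀ + β * deriv y₂ z₀ = 0 →
      α = 0 ∧ β = 0 := by
    intro α β e₁ e₂
    have h3 := (hcomb α β z₀ (hWb hz₀)).eventually_eq_zero hz₀r e₁ ((hder α β).trans e₂)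
    have h4 := AnalyticOnNhd.eqOn_zero_of_preconnected_of_eventuallyEq_zero
      (fun z hz ↦ (hcomb α β z hz).1) (convex_ball c ε).isPreconnected (hWb hz₀) h3
    exact hind α β (by filter_upwards [Metric.ball_mem_nhds c hε] with z hz using h4 hz)
  -- A zero Wronskian would make the rows of values and of derivatives give relations, which `hzero`
  -- declares trivial; then all entries vanish and `(1, 0)` is a forbidden relation.
  have hdet : y₁ z₀ * deriv y₂ z₀ - y₂ z₀ * deriv y₁ z₀ ≠ 0 := by
    intro hdet
    obtain ⟨e₁, e₂⟩ := hzero (y₂ z₀) (-y₁ z₀) (by ring) (by linear_combination -hdet)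
    obtain ⟨e₃, e₄⟩ := hzero (deriv y₂ z₀) (-deriv y₁ z₀) (by linear_combination hdet) (by ring)
    have := (hzero 1 0 (by linear_combination -e₂) (by linear_combination -e₄)).1
    exact one_ne_zero this
  set D := y₁ z₀ * deriv y₂ z₀ - y₂ z₀ * deriv y₁ z₀ with hD
  set α := (y z₀ * deriv y₂ z₀ - y₂ z₀ * deriv y z₀) / D with hα
  set β := (y₁ z₀ * deriv y z₀ - y z₀ * deriv y₁ z₀) / D with hβ
  have e₁ : α * y₁ z₀ + β * y₂ z₀ = y z₀ := by
    rw [hα, hβ]; field_simp; rw [hD]; ring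
  have e₂ : α * deriv y₁ z₀ + β * deriv y₂ z₀ = deriv y z₀ := by
    rw [hα, hβ]; field_simp; rw [hD]; ring
  refine ⟨_, hcomb α β, eqOn_of_eventuallyEq hy (fun z hz ↦ hcomb α β z (hWb hz)) hWc hz₀ ?_⟩
  have h5 := (hy z₀ hz₀).linear (hcomb α β z₀ (hWb hz₀)) 1 (-1)
  have h6 := h5.eventually_eq_zero hz₀r (by simp only [e₁]; ring) (by
    have := (((hy z₀ hz₀).1.differentiableAt.hasDerivAt.const_mul 1).add
      ((hcomb α β z₀ (hWb hz₀)).1.differentiableAt.hasDerivAt.const_mul (-1))).deriv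
    refine this.trans ?_
    rw [hder, e₂]; ring)
  filter_upwards [h6] with z hz
  linear_combination hz

lemma glue {P Q : ℂ → ℂ} {ι : Type*} {U : ι → Set ℂ} {f : ι → ℂ → ℂ} (hU : ∀ i, IsOpen (U i))
    (hf : ∀ i, ∀ z ∈ U i, LocSol P Q (f i) z)
    (hfg : ∀ i j, Set.EqOn (f i) (f j) (U i ∩ U j)) :
    ∃ F : ℂ → ℂ, (∀ i, Set.EqOn F (f i) (U i)) ∧ ∀ z ∈ ⋃ i, U i, LocSol P Q F z := by
  classical
  set F : ℂ → ℂ := fun z ↦ if h : ∃ i, z ∈ U i then f h.choose z else 0 with hF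
  have h1 : ∀ i, Set.EqOn F (f i) (U i) := by
    intro i z hz
    have h : ∃ i, z ∈ U i := ⟨i, hz⟩
    rw [hF]
    simp only [dif_pos h]
    exact hfg _ _ ⟨h.choose_spec, hz⟩
  refine ⟨F, h1, fun z hz ↦ ?_⟩
  obtain ⟨i, hi⟩ := Set.mem_iUnion.1 hz
  exact (hf i z hi).congr (by filter_upwards [(hU i).mem_nhds hi] with x hx using (h1 i hx).symm)

/-- The solution extends across each boundary point by `GoodEquation.local_extension`, and
compactness of the closed disc gives a uniform gain in radius. The local extensions agree because
two balls that overlap do so inside the open disc as well. -/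
lemma GoodEquation.extend_ball {P Q : ℂ → ℂ} (H : GoodEquation P Q) {R : ℝ} (hR : 0 < R)
    {y : ℂ → ℂ} (hy : ∀ z ∈ Metric.ball 0 R, LocSol P Q y z) :
    ∃ R' > R, ∃ y' : ℂ → ℂ, (∀ z ∈ Metric.ball 0 R', LocSol P Q y' z) ∧
      Set.EqOn y' y (Metric.ball 0 R) := by
  choose ε hε hext using H.local_extension
  have hne : ∀ c ∈ Metric.closedBall (0 : ℂ) R, ∀ V : Set ℂ, IsOpen V → c ∈ V →
      (Metric.ball 0 R ∩ V).Nonempty := by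
    intro c hc V hV hcV
    rw [← closure_ball (0 : ℂ) hR.ne'] at hc
    rw [Set.inter_comm]
    exact mem_closure_iff.1 hc V hV hcV
  have hloc : ∀ c : Metric.sphere (0 : ℂ) R, ∃ y' : ℂ → ℂ,
      (∀ z ∈ Metric.ball (c : ℂ) (ε c), LocSol P Q y' z) ∧
      Set.EqOn y y' (Metric.ball 0 R ∩ Metric.ball c (ε c)) := by
    intro c
    refine hext c _ (Metric.isOpen_ball.inter Metric.isOpen_ball) Set.inter_subset_right
      ((convex_ball _ _).inter (convex_ball _ _)).isPreconnected
      (hne c (Metric.sphere_subset_closedBall c.2) _ Metric.isOpen_ball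
        (Metric.mem_ball_self (hε c))) y fun z hz ↦ hy z hz.1
  choose Y hY hYy using hloc
  have hcompat : ∀ c c' : Metric.sphere (0 : ℂ) R,
      Set.EqOn (Y c) (Y c') (Metric.ball c (ε c) ∩ Metric.ball c' (ε c')) := by
    intro c c' z hz
    have hlt : ‖(c' : ℂ) - c‖ < ε c + ε c' := by
      rw [← dist_eq_norm]
      have h1 := hz.1
      have h2 := hz.2
      rw [Metric.mem_ball] at h1 h2
      calc dist (c' : ℂ) c ≤ dist (c' : ℂ) z + dist z c := dist_triangle _ _ _
        _ < ε c + ε c' := by rw [dist_comm (c' : ℂ) z]; linarith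
    have he := hε c
    have he' := hε c'
    -- The point dividing the segment from `c` to `c'` in the ratio of the radii lies in both balls,
    -- and in the closed disc by convexity. Hence the overlap meets the open disc, where both
    -- extensions equal `y`.
    set s : ℝ := ε c / (ε c + ε c') with hs
    have hs0 : 0 < s := by positivity
    have hs1 : 1 - s = ε c' / (ε c + ε c') := by rw [hs]; field_simp; ring
    have hs1' : 0 < 1 - s := by rw [hs1]; positivity
    set m : ℂ := (1 - s) • (c : ℂ) + s • (c' : ℂ) with hm
    have hmR : m ∈ Metric.closedBall (0 : ℂ) R :=
      convex_closedBall (0 : ℂ) R (Metric.sphere_subset_closedBall c.2)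
        (Metric.sphere_subset_closedBall c'.2) hs1'.le hs0.le (by ring)
    have hm1 : m ∈ Metric.ball (c : ℂ) (ε c) := by
      rw [Metric.mem_ball, dist_eq_norm, show m - c = s • ((c' : ℂ) - c) by rw [hm]; module,
        norm_smul, Real.norm_of_nonneg hs0.le, hs, div_mul_eq_mul_div, div_lt_iff₀ (by positivity)]
      gcongr
    have hm2 : m ∈ Metric.ball (c' : ℂ) (ε c') := by
      rw [Metric.mem_ball, dist_eq_norm, show m - c' = -((1 - s) • ((c' : ℂ) - c)) by rw [hm]; module,
        norm_neg, norm_smul, Real.norm_of_nonneg hs1'.le, hs1, div_mul_eq_mul_div,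
        div_lt_iff₀ (by positivity)]
      gcongr
    have hVo : IsOpen (Metric.ball (c : ℂ) (ε c) ∩ Metric.ball (c' : ℂ) (ε c')) :=
      Metric.isOpen_ball.inter Metric.isOpen_ball
    obtain ⟨x, hxB, hxV⟩ := hne m hmR _ hVo ⟨hm1, hm2⟩
    refine eqOn_of_eventuallyEq (fun z hz ↦ hY c z hz.1) (fun z hz ↦ hY c' z hz.2)
      ((convex_ball _ _).inter (convex_ball _ _)).isPreconnected hxV ?_ hz
    filter_upwards [hVo.mem_nhds hxV, Metric.isOpen_ball.mem_nhds hxB] with w hw hwB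
    rw [← hYy c ⟨hwB, hw.1⟩, ← hYy c' ⟨hwB, hw.2⟩]
  set U : Option (Metric.sphere (0 : ℂ) R) → Set ℂ := fun i ↦
    i.elim (Metric.ball 0 R) fun c ↦ Metric.ball c (ε c) with hUdef
  set f : Option (Metric.sphere (0 : ℂ) R) → ℂ → ℂ := fun i ↦ i.elim y Y with hfdef
  have hU : ∀ i, IsOpen (U i) := by rintro (_ | c) <;> exact Metric.isOpen_ball
  obtain ⟨F, hF1, hF2⟩ := glue (P := P) (Q := Q) (U := U) (f := f) hU
    (by
      rintro (_ | c) z hz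
      · exact hy z hz
      · exact hY c z hz)
    (by
      rintro (_ | c) (_ | c') z hz
      · rfl
      · exact hYy c' ⟨hz.1, hz.2⟩
      · exact (hYy c ⟨hz.2, hz.1⟩).symm
      · exact hcompat c c' hz)
  have hsub : Metric.closedBall (0 : ℂ) R ⊆ ⋃ i, U i := by
    intro z hz
    rcases (Metric.mem_closedBall.1 hz).lt_or_eq with h | h
    · exact Set.mem_iUnion.2 ⟨none, h⟩
    · exact Set.mem_iUnion.2 ⟨some ⟨z, h⟩, Metric.mem_ball_self (hε z)⟩
  obtain ⟨δ, hδ, hthick⟩ := (isCompact_closedBall (0 : ℂ) R).exists_thickening_subset_open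
    (isOpen_iUnion hU) hsub
  rw [thickening_closedBall hδ hR.le] at hthick
  exact ⟨δ + R, by linarith, F, fun z hz ↦ hF2 z (hthick hz), hF1 none⟩

/-- Were the radii of discs to which a fixed germ extends bounded, the extensions would glue to the
disc of supremal radius, and `GoodEquation.extend_ball` would exceed the supremum. -/
theorem GoodEquation.exists_entire {P Q : ℂ → ℂ} (H : GoodEquation P Q) :
    ∃ y : ℂ → ℂ, (∀ z, LocSol P Q y z) ∧ ∃ z, y z ≠ 0 := by
  obtain ⟨y₀, _, h₀, -, hind⟩ := H.basis 0
  set I : Set ℝ := {R | 0 < R ∧ ∃ y : ℂ → ℂ, (∀ z ∈ Metric.ball 0 R, LocSol P Q y z) ∧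
    y =ᶠ[𝓝 0] y₀} with hI
  have hglue : ∀ J ⊆ I, J.Nonempty → ∃ y : ℂ → ℂ,
      (∀ z ∈ ⋃ R : J, Metric.ball (0 : ℂ) R, LocSol P Q y z) ∧ y =ᶠ[𝓝 0] y₀ := by
    intro J hJ ⟨R₀, hR₀⟩
    choose hpos f hf hf0 using fun R : J ↦ hJ R.2
    obtain ⟨F, hF1, hF2⟩ := glue (P := P) (Q := Q) (U := fun R : J ↦ Metric.ball (0 : ℂ) R) (f := f)
      (fun _ ↦ Metric.isOpen_ball) hf (fun i j ↦ eqOn_of_eventuallyEq (fun z hz ↦ hf i z hz.1)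
        (fun z hz ↦ hf j z hz.2) ((convex_ball _ _).inter (convex_ball _ _)).isPreconnected
        (c := 0) ⟨Metric.mem_ball_self (hpos i), Metric.mem_ball_self (hpos j)⟩
        ((hf0 i).trans (hf0 j).symm))
    refine ⟨F, hF2, EventuallyEq.trans ?_ (hf0 ⟨R₀, hR₀⟩)⟩
    filter_upwards [Metric.ball_mem_nhds 0 (hpos ⟨R₀, hR₀⟩)] with z hz using hF1 ⟨R₀, hR₀⟩ hz
  obtain ⟨R₀, hR₀, hb⟩ := Metric.eventually_nhds_iff_ball.1 h₀.eventually
  have hR₀I : R₀ ∈ I := ⟨hR₀, y₀, hb, .rfl⟩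
  have hunb : ¬ BddAbove I := by
    intro hbdd
    have hs0 : 0 < sSup I := hR₀.trans_le (le_csSup hbdd hR₀I)
    obtain ⟨y, hy, hy0⟩ := hglue I subset_rfl ⟨R₀, hR₀I⟩
    obtain ⟨R', hR', y', hy', hyy'⟩ := H.extend_ball hs0 (y := y) fun z hz ↦ hy z <| by
      obtain ⟨R, hR, hzR⟩ := exists_lt_of_lt_csSup ⟨R₀, hR₀I⟩ (Metric.mem_ball.1 hz)
      exact Set.mem_iUnion.2 ⟨⟨R, hR⟩, hzR⟩
    have : R' ∈ I := ⟨hs0.trans hR', y', hy', EventuallyEq.trans (by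
      filter_upwards [Metric.ball_mem_nhds 0 hs0] with z hz using hyy' hz) hy0⟩
    exact absurd (le_csSup hbdd this) (not_le.2 hR')
  obtain ⟨y, hy, hy0⟩ := hglue I subset_rfl ⟨R₀, hR₀I⟩
  refine ⟨y, fun z ↦ hy z ?_, ?_⟩
  · obtain ⟨R, hR, hlt⟩ := not_bddAbove_iff.1 hunb ‖z‖
    exact Set.mem_iUnion.2 ⟨⟨R, hR⟩, by simpa using hlt⟩
  · by_contra! hzero
    have := (hind 1 0 (by filter_upwards [hy0] with z hz; rw [← hz, hzero z]; ring)).1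
    exact one_ne_zero this

/-! ### Local behaviour of the generalized Lamé equation -/

lemma analyticAt_zeta {L : PeriodPair} {z : ℂ} (hz : z ∉ L.lattice) : AnalyticAt ℂ (zeta L) z := by
  rw [analyticAt_iff_eventually_differentiableAt]
  filter_upwards [(isOpen_compl_lattice L).mem_nhds hz] with x hx
    using (hasDerivAt_zeta hx).differentiableAt

lemma eventually_sub_notMem (L : PeriodPair) (c a : ℂ) : ∀ᶠ z in 𝓝[≠] c, z - a ∉ L.lattice := by
  have ht : Tendsto (fun z ↦ z - a) (𝓝 c) (𝓝 (c - a)) := by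
    have : Continuous fun z : ℂ ↦ z - a := by fun_prop
    exact this.tendsto c
  filter_upwards [nhdsWithin_le_nhds (ht.eventually (L.compl_lattice_sdiff_singleton_mem_nhds (c - a))),
    self_mem_nhdsWithin] with z h1 h2 h3
  exact h1 ⟨h3, fun h ↦ h2 (by simpa using h)⟩

/-- `ζ` is the logarithmic derivative of `σ = z s` with `s 0 ≠ 0`. -/
lemma exists_zeta_eq_near_zero (L : PeriodPair) :
    ∃ g : ℂ → ℂ, AnalyticAt ℂ g 0 ∧ ∀ᶠ z in 𝓝[≠] 0, zeta L z = 1 / z + g z := by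
  set s : ℂ → ℂ := fun z ↦ ∏' l : L.lattice, sigmaFactor l z with hs
  have hsd : Differentiable ℂ s := differentiable_tprod_sigmaFactor L
  have hsa : AnalyticAt ℂ s 0 := hsd.analyticAt 0
  have hs0 : s 0 ≠ 0 := by simp [hs, sigmaFactor]
  refine ⟨fun z ↦ deriv s z / s z, hsa.deriv.div hsa hs0, ?_⟩
  filter_upwards [eventually_sub_notMem L 0 0] with z hz
  rw [sub_zero] at hz
  have h1 := (hasDerivAt_id z).mul (hsd z).hasDerivAt
  have h2 := (hasDerivAt_sigma hz).unique h1
  have h3 : s z ≠ 0 := tprod_sigmaFactor_ne_zero hz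
  have h4 := ne_zero_of_notMem hz
  have h5 : sigma L z = z * s z := rfl
  rw [h5] at h2
  simp only [id, one_mul] at h2
  field_simp
  linear_combination h2

lemma exists_zeta_eq_near (L : PeriodPair) {p c : ℂ} (hc : c - p ∈ L.lattice) :
    ∃ g : ℂ → ℂ, AnalyticAt ℂ g c ∧ ∀ᶠ z in 𝓝[≠] c, zeta L (z - p) = 1 / (z - c) + g z := by
  obtain ⟨g, hg, h⟩ := exists_zeta_eq_near_zero L
  refine ⟨fun z ↦ g (z - c) + quasiPeriod L (c - p),
    (AnalyticAt.comp_of_eq (g := g) hg (by fun_prop) (by simp)).add analyticAt_const, ?_⟩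
  have ht : Tendsto (fun z ↦ z - c) (𝓝[≠] c) (𝓝[≠] 0) := by
    refine tendsto_nhdsWithin_iff.2 ⟨?_, ?_⟩
    · have : Continuous fun z : ℂ ↦ z - c := by fun_prop
      simpa using (this.tendsto c).mono_left nhdsWithin_le_nhds
    · filter_upwards [self_mem_nhdsWithin] with z hz using sub_ne_zero.2 hz
  filter_upwards [ht.eventually h, eventually_sub_notMem L c c] with z hz hzc
  rw [show z - p = z - c + (c - p) by ring, zeta_add hc hzc, hz]
  ring

lemma exists_weierstrassP_eq_near (L : PeriodPair) {p c : ℂ} (hc : c - p ∈ L.lattice) :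
    ∃ g : ℂ → ℂ, AnalyticAt ℂ g c ∧ g c = 1 ∧
      ∀ᶠ z in 𝓝[≠] c, (z - c) ^ 2 * L.weierstrassP (z - p) = g z := by
  have h1 : AnalyticAt ℂ (fun z ↦ L.weierstrassPExcept (c - p) (z - p)) c :=
    AnalyticAt.comp_of_eq (L.analyticAt_weierstrassPExcept (c - p)) (by fun_prop) rfl
  refine ⟨fun z ↦ (z - c) ^ 2 * L.weierstrassPExcept (c - p) (z - p) + 1 -
    (z - c) ^ 2 / (c - p) ^ 2, ?_, by simp, ?_⟩
  -- For `c = p` the quotient by `(c - p)²` is `0` by convention, in accordance with the missing `1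
  -- / l²` at `l = 0` in `℘`.
  · by_cases h0 : c - p = 0
    · simp only [h0] at h1 ⊢
      simp only [ne_eq, OfNat.ofNat_ne_zero, not_false_eq_true, zero_pow, div_zero, sub_zero]
      fun_prop
    · have : (c - p) ^ 2 ≠ 0 := pow_ne_zero 2 h0
      fun_prop (disch := assumption)
  · filter_upwards [self_mem_nhdsWithin] with z hz
    have h2 := L.ite_eq_one_sub_sq_mul_weierstrassP (c - p) hc (z - p)
    rw [if_neg (by simpa using hz), show z - p - (c - p) = z - c by ring] at h2
    exact h2

/-- The logarithmic derivative of `∏ σ(z - p_i)^(n_i)`. -/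
def gauge (L : PeriodPair) {r : ℕ} (n p : Fin r → ℂ) (z : ℂ) : ℂ :=
  ∑ i, n i * zeta L (z - p i)

section

variable {L : PeriodPair} {r : ℕ} {n p A : Fin r → ℂ} {B : ℂ}

lemma analyticAt_zeta_sub {z a : ℂ} (hz : z - a ∉ L.lattice) :
    AnalyticAt ℂ (fun z ↦ zeta L (z - a)) z :=
  AnalyticAt.comp_of_eq (analyticAt_zeta hz) (by fun_prop) rfl

lemma analyticAt_weierstrassP_sub {z a : ℂ} (hz : z - a ∉ L.lattice) :
    AnalyticAt ℂ (fun z ↦ L.weierstrassP (z - a)) z :=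
  AnalyticAt.comp_of_eq (L.analyticOnNhd_weierstrassP _ hz) (by fun_prop) rfl

lemma analyticAt_gauge {z : ℂ} (hz : ∀ i, z - p i ∉ L.lattice) : AnalyticAt ℂ (gauge L n p) z :=
  Finset.univ.analyticAt_fun_sum fun i _ ↦ analyticAt_const.mul (analyticAt_zeta_sub (hz i))

lemma analyticAt_potential {z : ℂ} (hz : ∀ i, z - p i ∉ L.lattice) :
    AnalyticAt ℂ (potential L n p A B) z :=
  ((Finset.univ.analyticAt_fun_sum fun i _ ↦
    analyticAt_const.mul (analyticAt_weierstrassP_sub (hz i))).add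
    (Finset.univ.analyticAt_fun_sum fun i _ ↦ analyticAt_const.mul (analyticAt_zeta_sub (hz i)))).add
    analyticAt_const

lemma locData_zero {P Q : ℂ → ℂ} {c : ℂ} (hP : AnalyticAt ℂ P c) (hQ : AnalyticAt ℂ Q c) :
    LocData P Q c 0 where
  left := ⟨P, hP, by simp⟩
  right := ⟨fun z ↦ (z - c) ^ 2 * Q z, by fun_prop, by simp, by simp⟩

/-- Only the `i`-th terms are singular at `c`, as the `p_j` are distinct modulo `Λ`. The term `A_i
ζ` has a simple pole and does not influence the exponents. -/
lemma locData_lame (hp : ∀ i j, i ≠ j → p i - p j ∉ L.lattice) {c : ℂ} {i : Fin r}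
    (hc : c - p i ∈ L.lattice) : LocData (gauge L n p) (potential L n p A B) c (n i) := by
  have hother : ∀ j ∈ Finset.univ.erase i, c - p j ∉ L.lattice := by
    intro j hj h
    apply hp i j (Finset.ne_of_mem_erase hj).symm
    simpa using L.lattice.sub_mem h hc
  obtain ⟨g, hg, hζ⟩ := exists_zeta_eq_near L hc
  obtain ⟨q, hq, hqc, h℘⟩ := exists_weierstrassP_eq_near L hc
  have hsum : ∀ f : Fin r → ℂ, ∑ j, f j = f i + ∑ j ∈ Finset.univ.erase i, f j := fun f ↦
    (Finset.add_sum_erase _ f (Finset.mem_univ i)).symm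
  have hPa : ∀ m : Fin r → ℂ,
      AnalyticAt ℂ (fun z ↦ ∑ j ∈ Finset.univ.erase i, m j * zeta L (z - p j)) c := fun m ↦
    Finset.analyticAt_fun_sum _ fun j hj ↦ analyticAt_const.mul (analyticAt_zeta_sub (hother j hj))
  have hWa : AnalyticAt ℂ (fun z ↦ ∑ j ∈ Finset.univ.erase i,
      n j * (n j + 1) * L.weierstrassP (z - p j)) c :=
    Finset.analyticAt_fun_sum _ fun j hj ↦
      analyticAt_const.mul (analyticAt_weierstrassP_sub (hother j hj))
  refine ⟨⟨fun z ↦ n i * g z + ∑ j ∈ Finset.univ.erase i, n j * zeta L (z - p j),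
    (analyticAt_const.mul hg).add (hPa n), ?_⟩, ⟨fun z ↦ n i * (n i + 1) * q z + A i * ((z - c) +
      (z - c) ^ 2 * g z) + (z - c) ^ 2 * (∑ j ∈ Finset.univ.erase i,
      n j * (n j + 1) * L.weierstrassP (z - p j) +
      ∑ j ∈ Finset.univ.erase i, A j * zeta L (z - p j) + B), ?_, by simp [hqc], ?_⟩⟩
  · filter_upwards [hζ] with z hz
    rw [gauge, hsum, hz]
    ring
  · have := hPa A
    fun_prop
  · filter_upwards [hζ, h℘, self_mem_nhdsWithin] with z h1 h2 hz
    have h0 : z - c ≠ 0 := sub_ne_zero.2 hz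
    rw [potential, hsum fun j ↦ n j * (n j + 1) * L.weierstrassP (z - p j),
      hsum fun j ↦ A j * zeta L (z - p j), h1, ← h2]
    field_simp
    ring

lemma eventually_regular (L : PeriodPair) (p : Fin r → ℂ) (c : ℂ) :
    ∀ᶠ z in 𝓝[≠] c, ∀ i, z - p i ∉ L.lattice :=
  eventually_all.2 fun i ↦ eventually_sub_notMem L c (p i)

lemma gauge_add {z ω : ℂ} (hω : ω ∈ L.lattice) (hz : ∀ i, z - p i ∉ L.lattice) :
    gauge L n p (z + ω) = gauge L n p z + (∑ i, n i) * quasiPeriod L ω := by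
  simp only [gauge]
  rw [Finset.sum_mul, ← Finset.sum_add_distrib]
  refine Finset.sum_congr rfl fun i _ ↦ ?_
  rw [show z + ω - p i = z - p i + ω by ring, zeta_add hω (hz i)]
  ring

lemma potential_add (hA : ∑ i, A i = 0) {z ω : ℂ} (hω : ω ∈ L.lattice)
    (hz : ∀ i, z - p i ∉ L.lattice) :
    potential L n p A B (z + ω) = potential L n p A B z := by
  have h1 : ∑ i, A i * zeta L (z + ω - p i) =
      ∑ i, A i * zeta L (z - p i) + (∑ i, A i) * quasiPeriod L ω := by
    rw [Finset.sum_mul, ← Finset.sum_add_distrib]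
    refine Finset.sum_congr rfl fun i _ ↦ ?_
    rw [show z + ω - p i = z - p i + ω by ring, zeta_add hω (hz i)]
    ring
  rw [potential, potential, h1, hA, zero_mul, add_zero]
  congr 2
  refine Finset.sum_congr rfl fun i _ ↦ ?_
  rw [show z + ω - p i = z - p i + ω by ring, L.weierstrassP_add_coe _ ⟨ω, hω⟩]

end

/-! ### Twisted translations and a quasi-periodic solution -/

/-- Translation by `ω`, twisted by an exponential factor. -/
def twist (κ ω : ℂ) (y : ℂ → ℂ) (z : ℂ) : ℂ := exp (-κ * z) * y (z + ω)

/-- `(d/dz - P(z)) (exp(-κ z) f) = exp(-κ z) (f' - (P(z) + κ) f)`, and `P(z) + κ = P(z + ω)`. -/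
lemma odeDefect_twist {P Q y : ℂ → ℂ} {κ ω z : ℂ} (hP : ∀ᶠ x in 𝓝 z, P (x + ω) = P x + κ)
    (hQ : Q (z + ω) = Q z) (hy : AnalyticAt ℂ y (z + ω)) :
    odeDefect P Q (twist κ ω y) z = exp (-κ * z) * odeDefect P Q y (z + ω) := by
  have ht : Tendsto (fun x ↦ x + ω) (𝓝 z) (𝓝 (z + ω)) := by
    have : Continuous fun x : ℂ ↦ x + ω := by fun_prop
    exact this.tendsto z
  have he : ∀ x, HasDerivAt (fun x ↦ exp (-κ * x)) (exp (-κ * x) * -κ) x := fun x ↦ by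
    simpa using ((hasDerivAt_id x).const_mul (-κ)).cexp
  have d1 : ∀ᶠ x in 𝓝 z, deriv (twist κ ω y) x =
      exp (-κ * x) * (deriv y (x + ω) - κ * y (x + ω)) := by
    filter_upwards [ht.eventually hy.eventually_analyticAt] with x hx
    exact ((he x).mul (hx.differentiableAt.hasDerivAt.comp_add_const x ω)).deriv.trans (by ring)
  have d2 : deriv (deriv (twist κ ω y)) z = _ := (EventuallyEq.deriv_eq d1).trans
    ((he z).mul ((hy.deriv.differentiableAt.hasDerivAt.comp_add_const z ω).sub
      ((hy.differentiableAt.hasDerivAt.comp_add_const z ω).const_mul κ))).deriv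
  have hdP : deriv P (z + ω) = deriv P z := by
    rw [← deriv_comp_add_const, EventuallyEq.deriv_eq hP, deriv_add_const]
  rw [odeDefect, odeDefect, d2, d1.self_of_nhds, hdP, hP.self_of_nhds, hQ]
  simp only [twist, Pi.sub_apply]
  ring

lemma locSol_twist {P Q y : ℂ → ℂ} {κ ω c : ℂ} (hP : ∀ᶠ x in 𝓝[≠] c, P (x + ω) = P x + κ)
    (hQ : ∀ᶠ x in 𝓝[≠] c, Q (x + ω) = Q x) (hy : LocSol P Q y (c + ω)) :
    LocSol P Q (twist κ ω y) c := by
  have hc : AnalyticAt ℂ (fun z : ℂ ↦ z + ω) c := by fun_prop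
  refine ⟨AnalyticAt.mul (by fun_prop) (AnalyticAt.comp_of_eq (g := y) hy.1 hc rfl), ?_⟩
  have ht : Tendsto (fun x ↦ x + ω) (𝓝[≠] c) (𝓝[≠] (c + ω)) := by
    refine tendsto_nhdsWithin_iff.2 ⟨hc.continuousAt.tendsto.mono_left nhdsWithin_le_nhds, ?_⟩
    filter_upwards [self_mem_nhdsWithin] with z hz
    simpa using hz
  filter_upwards [eventually_punctured_nhds hP, hQ, ht.eventually hy.2,
    ht.eventually (nhdsWithin_le_nhds hy.1.eventually_analyticAt)] with z h1 h2 h3 h4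
  rw [odeDefect_twist h1 h2 h4, h3, mul_zero]

/-- Log-freeness is assumed only at the `p_i`; this carries the local basis to `p_i + Λ`. -/
lemma HasLocalBasis.translate {P Q : ℂ → ℂ} {κ ω c : ℂ}
    (hP : ∀ᶠ x in 𝓝[≠] c, P (x + ω) = P x + κ) (hQ : ∀ᶠ x in 𝓝[≠] c, Q (x + ω) = Q x)
    (h : HasLocalBasis P Q (c + ω)) : HasLocalBasis P Q c := by
  obtain ⟨y₁, y₂, h₁, h₂, hind⟩ := h
  refine ⟨_, _, locSol_twist hP hQ h₁, locSol_twist hP hQ h₂, fun α β hαβ ↦ hind α β ?_⟩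
  have ht : Tendsto (fun x ↦ x - ω) (𝓝 (c + ω)) (𝓝 c) := by
    have : Continuous fun x : ℂ ↦ x - ω := by fun_prop
    simpa using this.tendsto (c + ω)
  filter_upwards [ht.eventually hαβ] with z hz
  simp only [twist, sub_add_cancel] at hz
  have : exp (-κ * (z - ω)) * (α * y₁ z + β * y₂ z) = 0 := by linear_combination hz
  exact (mul_eq_zero.1 this).resolve_left (exp_ne_zero _)

theorem goodEquation_lame {L : PeriodPair} {r : ℕ} {n p A : Fin r → ℂ} {B : ℂ}
    (hp : ∀ i j, i ≠ j → p i - p j ∉ L.lattice) (hA : ∑ i, A i = 0)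
    (hn : ∀ i, ∃ m : ℕ, n i = (m : ℂ) / 2)
    (hlog : ∀ i, LogFreeAt (potential L n p A B) (p i) (n i)) :
    GoodEquation (gauge L n p) (potential L n p A B) := by
  refine ⟨fun c ↦ ?_, fun c ↦ ?_⟩
  · by_cases hc : ∀ i, c - p i ∉ L.lattice
    · exact hasLocalBasis_of_analyticAt (analyticAt_gauge hc) (analyticAt_potential hc)
    · push Not at hc
      obtain ⟨i, hi⟩ := hc
      have hω : p i - c ∈ L.lattice := by simpa using L.lattice.neg_mem hi
      obtain ⟨m, hm⟩ := hn i
      refine HasLocalBasis.translate (ω := p i - c) (κ := (∑ i, n i) * quasiPeriod L (p i - c))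
        ?_ ?_ ?_
      · filter_upwards [eventually_regular L p c] with z hz using gauge_add hω hz
      · filter_upwards [eventually_regular L p c] with z hz using potential_add hA hω hz
      · rw [add_sub_cancel]
        exact hasLocalBasis_of_logFree hm (locData_lame hp (by simp)) (hlog i)
  · filter_upwards [eventually_regular L p c] with z hz
      using locData_zero (analyticAt_gauge hz) (analyticAt_potential hz)

lemma exists_common_eigenvector {V : Type*} [AddCommGroup V] [Module ℂ V] [FiniteDimensional ℂ V]
    [Nontrivial V] {f g : Module.End ℂ V} (h : Commute f g) :
    ∃ (v : V) (μ ν : ℂ), v ≠ 0 ∧ f v = μ • v ∧ g v = ν • v := by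
  obtain ⟨μ, hμ⟩ := Module.End.exists_eigenvalue f
  have hmaps : ∀ x ∈ f.eigenspace μ, g x ∈ f.eigenspace μ :=
    Module.End.mapsTo_genEigenspace_of_comm h μ 1
  have : Nontrivial (f.eigenspace μ) := Submodule.nontrivial_iff_ne_bot.2 hμ
  obtain ⟨ν, hν⟩ := Module.End.exists_eigenvalue (g.restrict hmaps)
  obtain ⟨⟨v, hv⟩, hv'⟩ := hν.exists_hasEigenvector
  refine ⟨v, μ, ν, ?_, Module.End.mem_eigenspace_iff.1 hv, ?_⟩
  · intro h0; exact hv'.2 (by simp [h0])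
  · have := congrArg Subtype.val hv'.apply_eq_smul
    simpa using this

/-- The space of entire solutions. -/
def entireSolutions (P Q : ℂ → ℂ) : Submodule ℂ (ℂ → ℂ) where
  carrier := {y | ∀ z, LocSol P Q y z}
  add_mem' := fun ha hb z ↦ by simpa using! (ha z).linear (hb z) 1 1
  zero_mem' := fun z ↦ ⟨analyticAt_const, .of_forall fun x ↦ by
    have h : deriv (0 : ℂ → ℂ) = 0 := by ext; exact deriv_const _ _
    simp [odeDefect, h]⟩
  smul_mem' := fun a y hy z ↦ by simpa using! (hy z).linear (hy z) a 0

lemma differentiable_of_locSol {P Q y : ℂ → ℂ} (hy : ∀ z, LocSol P Q y z) : Differentiable ℂ y :=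
  fun z ↦ (hy z).1.differentiableAt

lemma eq_zero_of_eventually {P Q y : ℂ → ℂ} (hy : ∀ z, LocSol P Q y z) {c : ℂ}
    (h : ∀ᶠ z in 𝓝 c, y z = 0) : y = 0 := by
  have := AnalyticOnNhd.eqOn_zero_of_preconnected_of_eventuallyEq_zero (U := Set.univ)
    (fun z _ ↦ (hy z).1) isPreconnected_univ (Set.mem_univ c) h
  exact funext fun z ↦ this (Set.mem_univ z)

lemma finiteDimensional_entireSolutions {P Q : ℂ → ℂ} (H : GoodEquation P Q) :
    FiniteDimensional ℂ (entireSolutions P Q) := by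
  obtain ⟨z₀, hz₀⟩ := (H.regular 0).exists
  let φ : entireSolutions P Q →ₗ[ℂ] ℂ × ℂ :=
    { toFun := fun y ↦ (y.1 z₀, deriv y.1 z₀)
      map_add' := fun a b ↦ by
        have := deriv_add (f := a.1) (g := b.1) (a.2 z₀).1.differentiableAt
          (b.2 z₀).1.differentiableAt
        simp [this]
      map_smul' := fun c a ↦ by
        have := deriv_const_smul (f := a.1) c (a.2 z₀).1.differentiableAt
        simp [this] }
  refine FiniteDimensional.of_injective φ ((injective_iff_map_eq_zero φ).2 fun y hy ↦ ?_)
  have h1 : (y.1 z₀, deriv y.1 z₀) = (0, 0) := hy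
  rw [Prod.mk.injEq] at h1
  exact Subtype.ext (eq_zero_of_eventually y.2 ((y.2 z₀).eventually_eq_zero hz₀ h1.1 h1.2))

/-- The action of a twisted translation on entire solutions. -/
def twistEnd {P Q : ℂ → ℂ} (κ ω : ℂ) (hP : ∀ c, ∀ᶠ x in 𝓝[≠] c, P (x + ω) = P x + κ)
    (hQ : ∀ c, ∀ᶠ x in 𝓝[≠] c, Q (x + ω) = Q x) : Module.End ℂ (entireSolutions P Q) where
  toFun y := ⟨twist κ ω y.1, fun z ↦ locSol_twist (hP z) (hQ z) (y.2 (z + ω))⟩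
  map_add' a b := by ext z; simp [twist, mul_add]
  map_smul' c a := by ext z; simp [twist]; ring

/-- The solution is a common eigenvector of the two twisted translations. -/
theorem exists_quasiperiodic_solution {L : PeriodPair} {r : ℕ} {n p A : Fin r → ℂ} {B : ℂ}
    (hA : ∑ i, A i = 0) (htot : ∃ k : ℤ, ∑ i, n i = (k : ℂ))
    (H : GoodEquation (gauge L n p) (potential L n p A B)) :
    ∃ y : ℂ → ℂ, (∀ z, LocSol (gauge L n p) (potential L n p A B) y z) ∧ y ≠ 0 ∧
      ∀ ω, ω = L.ω₁ ∨ ω = L.ω₂ → ∃ μ : ℂ, μ ≠ 0 ∧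
        ∀ z, y (z + ω) = μ * exp ((∑ i, n i) * quasiPeriod L ω * z) * y z := by
  set K := ∑ i, n i with hK
  have hP : ∀ ω ∈ L.lattice, ∀ c, ∀ᶠ x in 𝓝[≠] c,
      gauge L n p (x + ω) = gauge L n p x + K * quasiPeriod L ω := fun ω hω c ↦ by
    filter_upwards [eventually_regular L p c] with z hz using gauge_add hω hz
  have hQ : ∀ ω ∈ L.lattice, ∀ c, ∀ᶠ x in 𝓝[≠] c,
      potential L n p A B (x + ω) = potential L n p A B x := fun ω hω c ↦ by
    filter_upwards [eventually_regular L p c] with z hz using potential_add hA hω hz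
  have := finiteDimensional_entireSolutions H
  have : Nontrivial (entireSolutions (gauge L n p) (potential L n p A B)) := by
    obtain ⟨y, hy, z, hz⟩ := H.exists_entire
    exact ⟨⟨y, hy⟩, 0, fun h ↦ hz (congrFun (congrArg Subtype.val h) z)⟩
  have hcomm : Commute (twistEnd _ _ (hP _ L.ω₁_mem_lattice) (hQ _ L.ω₁_mem_lattice))
      (twistEnd _ _ (hP _ L.ω₂_mem_lattice) (hQ _ L.ω₂_mem_lattice)) := by
    ext y z
    simp only [Module.End.mul_apply, twistEnd, LinearMap.coe_mk, AddHom.coe_mk, twist]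
    rw [add_right_comm z L.ω₂ L.ω₁, ← mul_assoc, ← mul_assoc, ← exp_add, ← exp_add]
    congr 1
    obtain ⟨k, hk⟩ := htot
    -- This is the discrepancy between the two orders of composition; it is trivial because `K = ∑
    -- n_i` is an integer.
    have h1 : exp (K * (quasiPeriod L L.ω₁ * L.ω₂ - quasiPeriod L L.ω₂ * L.ω₁)) = 1 := by
      rw [hk, exp_int_mul, exp_legendre, one_zpow]
    rw [← mul_one (exp (_ + -(K * quasiPeriod L L.ω₁) * (z + L.ω₂))), ← h1, ← exp_add]
    congr 1
    ring
  obtain ⟨⟨y, hy⟩, μ, ν, hy0, h₁, h₂⟩ := exists_common_eigenvector hcomm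
  have hy0' : y ≠ 0 := fun h ↦ hy0 (Subtype.ext h)
  refine ⟨y, hy, hy0', ?_⟩
  have key : ∀ (ω : ℂ) (hω : ω ∈ L.lattice) (μ : ℂ),
      twistEnd _ _ (hP _ hω) (hQ _ hω) ⟨y, hy⟩ = μ • ⟨y, hy⟩ → μ ≠ 0 ∧
        ∀ z, y (z + ω) = μ * exp (K * quasiPeriod L ω * z) * y z := by
    intro ω hω μ h
    have h3 : ∀ z, exp (-(K * quasiPeriod L ω) * z) * y (z + ω) = μ * y z := fun z ↦
      congrFun (congrArg Subtype.val h) z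
    have h4 : ∀ z, y (z + ω) = μ * exp (K * quasiPeriod L ω * z) * y z := fun z ↦ by
      have h5 := h3 z
      rw [neg_mul, exp_neg] at h5
      have := exp_ne_zero (K * quasiPeriod L ω * z)
      field_simp at h5
      linear_combination h5
    refine ⟨fun h0 ↦ hy0' (funext fun z ↦ ?_), h4⟩
    have := h4 (z - ω)
    simpa [h0] using this
  rintro ω (rfl | rfl)
  · exact ⟨μ, key _ L.ω₁_mem_lattice μ h₁⟩
  · exact ⟨ν, key _ L.ω₂_mem_lattice ν h₂⟩

/-! ### Factorization into sigma functions -/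

/-- `f / D` has meromorphic order `0` everywhere, so its normal form is entire without zeros. The
raw quotient has the default value `0` at the zeros of `D`. -/
lemma exists_factor {f D : ℂ → ℂ} (hf : Differentiable ℂ f) (hD : Differentiable ℂ D)
    (h : ∀ z, analyticOrderAt f z = analyticOrderAt D z) (htop : ∀ z, analyticOrderAt D z ≠ ⊤) :
    ∃ g : ℂ → ℂ, Differentiable ℂ g ∧ (∀ z, g z ≠ 0) ∧ ∀ z, f z = g z * D z := by
  set q : ℂ → ℂ := fun z ↦ f z / D z with hq
  have hmer : ∀ z, MeromorphicAt q z := fun z ↦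
    (hf.analyticAt z).meromorphicAt.div (hD.analyticAt z).meromorphicAt
  have hmerOn : MeromorphicOn q Set.univ := fun z _ ↦ hmer z
  have hDne : ∀ z, ∀ᶠ x in 𝓝[≠] z, D x ≠ 0 := fun z ↦
    (hD.analyticAt z).eventually_eq_zero_or_eventually_ne_zero.resolve_left
      (mt analyticOrderAt_eq_top.2 (htop z))
  have hord : ∀ z, meromorphicOrderAt q z = 0 := by
    intro z
    obtain ⟨k, hk⟩ := ENat.ne_top_iff_exists.1 (htop z)
    obtain ⟨v, hv, hvz, hDv⟩ := (hD.analyticAt z).analyticOrderAt_eq_natCast.1 hk.symm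
    obtain ⟨u, hu, huz, hfu⟩ := (hf.analyticAt z).analyticOrderAt_eq_natCast.1 ((h z).trans hk.symm)
    refine (meromorphicOrderAt_eq_int_iff (n := 0) (hmer z)).2
      ⟨fun x ↦ u x / v x, hu.div hv hvz, div_ne_zero huz hvz, ?_⟩
    filter_upwards [nhdsWithin_le_nhds hDv, nhdsWithin_le_nhds hfu, self_mem_nhdsWithin]
      with x h1 h2 hx
    have : x - z ≠ 0 := sub_ne_zero.2 hx
    simp only [hq, h1, h2, zpow_zero, smul_eq_mul]
    rw [mul_div_mul_left _ _ (pow_ne_zero k this), one_mul]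
  set g := toMeromorphicNFOn q Set.univ with hg
  have hNF : ∀ z, MeromorphicNFAt g z := fun z ↦ meromorphicNFOn_toMeromorphicNFOn q _ (Set.mem_univ z)
  have hordg : ∀ z, meromorphicOrderAt g z = 0 := fun z ↦
    (meromorphicOrderAt_toMeromorphicNFOn hmerOn (Set.mem_univ z)).trans (hord z)
  have hga : ∀ z, AnalyticAt ℂ g z := fun z ↦
    (hNF z).meromorphicOrderAt_nonneg_iff_analyticAt.1 (hordg z).ge
  refine ⟨g, fun z ↦ (hga z).differentiableAt, fun z ↦
    (hNF z).meromorphicOrderAt_eq_zero_iff.1 (hordg z), fun z ↦ ?_⟩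
  have hev : ∀ᶠ x in 𝓝[≠] z, f x = g x * D x := by
    filter_upwards [hmerOn.toMeromorphicNFOn_eq_self_on_nhdsNE (Set.mem_univ z), hDne z]
      with x h1 h2
    rw [hg, h1, hq]
    field_simp
  exact (((hf.analyticAt z).frequently_eq_iff_eventually_eq
    ((hga z).mul (hD.analyticAt z))).1 hev.frequently).self_of_nhds

lemma deriv_add_period {f : ℂ → ℂ} {ω c : ℂ} (h : ∀ z, f (z + ω) = f z + c) :
    Function.Periodic (deriv f) ω := fun z ↦ by
  rw [← deriv_comp_add_const, funext h]
  exact deriv_add_const _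

lemma eq_const_of_periodic {L : PeriodPair} {f : ℂ → ℂ} (hf : Differentiable ℂ f)
    (h₁ : Function.Periodic f L.ω₁) (h₂ : Function.Periodic f L.ω₂) (z : ℂ) : f z = f 0 := by
  obtain ⟨M, hM⟩ := isBounded_range_of_periodic (L := L) hf.continuous.norm fun l hl z ↦ by
    simp only [periodic_of_generators h₁ h₂ hl z]
  exact hf.apply_eq_apply_of_bounded
    (isBounded_iff_forall_norm_le.2 ⟨M, by rintro _ ⟨z, rfl⟩; exact hM z⟩) z 0

/-- A nowhere vanishing entire function with the quasi-periodicity of `σ^κ` is an exponential, and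
`κ = 0`. -/
lemma exists_exp_of_quasiperiodic {L : PeriodPair} {g : ℂ → ℂ} (hg : Differentiable ℂ g)
    (hg0 : ∀ z, g z ≠ 0) {κ : ℂ}
    (h : ∀ ω, ω = L.ω₁ ∨ ω = L.ω₂ → ∃ μ : ℂ, ∀ z,
      g (z + ω) = μ * exp (κ * quasiPeriod L ω * z) * g z) :
    κ = 0 ∧ ∃ C h : ℂ, C ≠ 0 ∧ ∀ z, g z = C * exp (h * z) := by
  have hg' : Differentiable ℂ (deriv g) := fun z ↦ (hg.analyticAt z).deriv.differentiableAt
  set u : ℂ → ℂ := fun z ↦ deriv g z / g z with hu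
  have hud : Differentiable ℂ u := hg'.div hg hg0
  have hud' : Differentiable ℂ (deriv u) := fun z ↦ (hud.analyticAt z).deriv.differentiableAt
  have hadd : ∀ ω, ω = L.ω₁ ∨ ω = L.ω₂ → ∀ z, u (z + ω) = u z + κ * quasiPeriod L ω := by
    intro ω hω z
    obtain ⟨μ, hμ⟩ := h ω hω
    have h1 : deriv g (z + ω) =
        μ * exp (κ * quasiPeriod L ω * z) * (κ * quasiPeriod L ω * g z + deriv g z) := by
      rw [← deriv_comp_add_const, funext hμ]
      have h2 := ((((hasDerivAt_id z).const_mul (κ * quasiPeriod L ω)).cexp.const_mul μ).mul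
        (hg z).hasDerivAt).deriv
      refine h2.trans ?_
      simp only [id]
      ring
    have h3 := hg0 (z + ω)
    rw [hμ] at h3
    have h4 : μ ≠ 0 := by rintro rfl; simp at h3
    have h5 := hg0 z
    have h6 := exp_ne_zero (κ * quasiPeriod L ω * z)
    simp only [hu]
    rw [h1, hμ]
    field_simp
    ring
  -- `u = g'/g` changes by constants under periods, so `u'` is entire and elliptic, hence constant.
  have hconst : ∀ z, deriv u z = deriv u 0 := eq_const_of_periodic hud'
    (deriv_add_period (hadd _ (.inl rfl))) (deriv_add_period (hadd _ (.inr rfl)))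
  set b := deriv u 0 with hb
  have hlin : ∀ z, u z = b * z + u 0 := by
    intro z
    have hd : Differentiable ℂ fun z ↦ u z - b * z := by fun_prop
    have h1 := is_const_of_deriv_eq_zero hd (fun z ↦ by
      have := ((hud z).hasDerivAt.sub ((hasDerivAt_id z).const_mul b)).deriv
      refine this.trans ?_
      rw [hconst z]; ring) z 0
    simp only [mul_zero, sub_zero] at h1
    linear_combination h1
  have hper : ∀ ω, ω = L.ω₁ ∨ ω = L.ω₂ → b * ω = κ * quasiPeriod L ω := by
    intro ω hω
    have h1 := hadd ω hω 0
    rw [zero_add, hlin ω] at h1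
    linear_combination h1
  have e₁ := hper _ (.inl rfl)
  have e₂ := hper _ (.inr rfl)
  -- The relations `b ω_j = κ η_j` for `j = 1, 2` yield `κ (η₁ ω₂ - η₂ ω₁) = 0`.
  have hκ : κ = 0 := by
    have : κ * (quasiPeriod L L.ω₁ * L.ω₂ - quasiPeriod L L.ω₂ * L.ω₁) = 0 := by
      linear_combination -L.ω₂ * e₁ + L.ω₁ * e₂
    exact (mul_eq_zero.1 this).resolve_right (sub_ne_zero.2 (legendre_ne L))
  have hω₁ : L.ω₁ ≠ 0 := by
    intro h; apply L.ω₁_div_two_notMem_lattice; simp [h]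
  have hb0 : b = 0 := by
    rw [hκ, zero_mul] at e₁
    exact (mul_eq_zero.1 e₁).resolve_right hω₁
  refine ⟨hκ, g 0, u 0, hg0 0, fun z ↦ ?_⟩
  have hd : ∀ z, HasDerivAt (fun z ↦ g z * exp (-(u 0 * z))) 0 z := by
    intro z
    have h1 := (hg z).hasDerivAt.mul (((hasDerivAt_id z).const_mul (u 0)).neg.cexp)
    refine h1.congr_deriv ?_
    have h2 := hlin z
    rw [hb0, zero_mul, zero_add] at h2
    have h3 : deriv g z = u 0 * g z := by
      rw [← h2]; simp only [hu]; have := hg0 z; field_simp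
    simp only [id, h3, Pi.neg_apply]
    ring
  have h2 := is_const_of_deriv_eq_zero (fun z ↦ (hd z).differentiableAt) (fun z ↦ (hd z).deriv) z 0
  simp only [mul_zero, neg_zero, exp_zero, mul_one] at h2
  rw [← h2, mul_assoc, ← exp_add]
  simp

lemma finite_zeros {y : ℂ → ℂ} (hy : Differentiable ℂ y) (h0 : y ≠ 0) (R : ℝ) :
    ({z | y z = 0} ∩ Metric.closedBall 0 R).Finite := by
  by_contra hinf
  obtain ⟨x, -, hx⟩ := Set.Infinite.exists_accPt_of_subset_isCompact hinf
    (isCompact_closedBall (0 : ℂ) R) Set.inter_subset_right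
  rw [accPt_iff_frequently_nhdsNE] at hx
  have h1 := (hy.analyticAt x).frequently_zero_iff_eventually_zero.1 (hx.mono fun z hz ↦ hz.1)
  have := AnalyticOnNhd.eqOn_zero_of_preconnected_of_eventuallyEq_zero (U := Set.univ)
    (fun z _ ↦ hy.analyticAt z) isPreconnected_univ (Set.mem_univ x) h1
  exact h0 (funext fun z ↦ this (Set.mem_univ z))

/-- A lattice-invariant, locally finite set has a finite system of representatives. -/
lemma exists_representatives {L : PeriodPair} {Z : Set ℂ}
    (hinv : ∀ z ∈ Z, ∀ l ∈ L.lattice, z - l ∈ Z)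
    (hfin : ∀ R : ℝ, (Z ∩ Metric.closedBall 0 R).Finite) :
    ∃ (N : ℕ) (a : Fin N → ℂ), (∀ μ, a μ ∈ Z) ∧ (∀ μ κ, μ ≠ κ → a μ - a κ ∉ L.lattice) ∧
      ∀ z ∈ Z, ∃ μ, z - a μ ∈ L.lattice := by
  obtain ⟨R, hR⟩ := exists_lattice_norm_sub_le L
  set mk : ℂ → ℂ ⧸ L.lattice := Submodule.Quotient.mk with hmk
  have hT : (mk '' Z).Finite := by
    refine ((hfin R).image mk).subset ?_
    rintro _ ⟨z, hz, rfl⟩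
    obtain ⟨l, hl, hzl⟩ := hR z
    refine ⟨z - l, ⟨hinv z hz l hl, by simpa using hzl⟩, ?_⟩
    rw [hmk, Submodule.Quotient.eq]
    simpa using L.lattice.neg_mem hl
  have := hT.to_subtype
  obtain ⟨N, ⟨e⟩⟩ := Finite.exists_equiv_fin (mk '' Z)
  choose a haZ ha using fun μ : Fin N ↦ (e.symm μ).2
  refine ⟨N, a, haZ, fun μ κ hne h ↦ hne ?_, fun z hz ↦ ⟨e ⟨mk z, z, hz, rfl⟩, ?_⟩⟩
  · have h1 : mk (a μ) = mk (a κ) := (Submodule.Quotient.eq _).2 h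
    rw [ha, ha] at h1
    exact e.symm.injective (Subtype.ext h1)
  · rw [← Submodule.Quotient.eq]
    have := ha (e ⟨mk z, z, hz, rfl⟩)
    rw [Equiv.symm_apply_apply] at this
    exact this.symm

lemma analyticOrderAt_fun_prod {ι : Type*} (s : Finset ι) {f : ι → ℂ → ℂ} {c : ℂ}
    (hf : ∀ i ∈ s, AnalyticAt ℂ (f i) c) :
    analyticOrderAt (fun z ↦ ∏ i ∈ s, f i z) c = ∑ i ∈ s, analyticOrderAt (f i) c := by
  classical
  induction s using Finset.induction_on with
  | empty => simp [analyticOrderAt_eq_zero]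
  | insert i s hi ih =>
    have h1 : (fun z ↦ ∏ j ∈ insert i s, f j z) = f i * fun z ↦ ∏ j ∈ s, f j z := by
      ext z; simp [Finset.prod_insert hi]
    rw [h1, analyticOrderAt_mul (hf i (Finset.mem_insert_self i s))
      (s.analyticAt_fun_prod fun j hj ↦ hf j (Finset.mem_insert_of_mem hj)),
      ih fun j hj ↦ hf j (Finset.mem_insert_of_mem hj), Finset.sum_insert hi]

lemma analyticOrderAt_periodic {y e : ℂ → ℂ} {ω : ℂ} (hy : Differentiable ℂ y)
    (he : Differentiable ℂ e) (he0 : ∀ z, e z ≠ 0) (h : ∀ z, y (z + ω) = e z * y z) :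
    Function.Periodic (analyticOrderAt y) ω := by
  intro c
  have hd : deriv (fun z : ℂ ↦ z + ω) c ≠ 0 := by simp
  have h1 := analyticOrderAt_comp_of_deriv_ne_zero (f := y) (g := fun z : ℂ ↦ z + ω) (z₀ := c)
    (by fun_prop) hd
  rw [← h1, show y ∘ (fun z ↦ z + ω) = e * y from funext h,
    analyticOrderAt_mul (he.analyticAt c) (hy.analyticAt c),
    (he.analyticAt c).analyticOrderAt_eq_zero.2 (he0 c), zero_add]

section

variable {L : PeriodPair} {r : ℕ} {n p A : Fin r → ℂ} {B : ℂ}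

/-- The product `∏ σ(z - a_μ) ∏ σ(z - p_i)^(k_i)`. -/
def sigmaProd (L : PeriodPair) {r N : ℕ} (p : Fin r → ℂ) (k : Fin r → ℕ) (a : Fin N → ℂ) (z : ℂ) : ℂ :=
  (∏ μ, sigma L (z - a μ)) * ∏ i, sigma L (z - p i) ^ k i

lemma differentiable_sigma_sub (L : PeriodPair) (a : ℂ) :
    Differentiable ℂ fun z ↦ sigma L (z - a) :=
  (differentiable_sigma L).comp (differentiable_id.sub_const a)

lemma differentiable_sigmaProd (L : PeriodPair) {N : ℕ} (p : Fin r → ℂ) (k : Fin r → ℕ)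
    (a : Fin N → ℂ) : Differentiable ℂ (sigmaProd L p k a) :=
  (Differentiable.fun_finsetProd fun μ _ ↦ differentiable_sigma_sub L (a μ)).mul
    (Differentiable.fun_finsetProd fun i _ ↦ (differentiable_sigma_sub L (p i)).pow (k i))

lemma sigmaProd_ne_zero {N : ℕ} {k : Fin r → ℕ} {a : Fin N → ℂ} {z : ℂ}
    (ha : ∀ μ, z - a μ ∉ L.lattice) (hz : ∀ i, z - p i ∉ L.lattice) :
    sigmaProd L p k a z ≠ 0 :=
  mul_ne_zero (Finset.prod_ne_zero_iff.2 fun μ _ ↦ sigma_ne_zero (ha μ))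
    (Finset.prod_ne_zero_iff.2 fun i _ ↦ pow_ne_zero _ (sigma_ne_zero (hz i)))

open scoped Classical in
lemma analyticOrderAt_sigmaProd {N : ℕ} (k : Fin r → ℕ) (a : Fin N → ℂ) (c : ℂ) :
    analyticOrderAt (sigmaProd L p k a) c =
      ∑ μ, (if c - a μ ∈ L.lattice then 1 else 0) +
        ∑ i, k i • (if c - p i ∈ L.lattice then (1 : ℕ∞) else 0) := by
  have h1 : ∀ a, AnalyticAt ℂ (fun z ↦ sigma L (z - a)) c := fun a ↦
    (differentiable_sigma_sub L a).analyticAt c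
  have h2 : sigmaProd L p k a =
      (fun z ↦ ∏ μ, sigma L (z - a μ)) * fun z ↦ ∏ i, sigma L (z - p i) ^ k i := rfl
  rw [h2, analyticOrderAt_mul (Finset.univ.analyticAt_fun_prod fun μ _ ↦ h1 (a μ))
    (Finset.univ.analyticAt_fun_prod fun i _ ↦ (h1 (p i)).fun_pow (k i)),
    analyticOrderAt_fun_prod _ (fun μ _ ↦ h1 (a μ)),
    analyticOrderAt_fun_prod _ (fun i _ ↦ (h1 (p i)).fun_pow (k i))]
  congr 1
  · exact Finset.sum_congr rfl fun μ _ ↦ analyticOrderAt_sigma_sub L (a μ) c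
  · refine Finset.sum_congr rfl fun i _ ↦ ?_
    rw [← analyticOrderAt_sigma_sub L (p i) c]
    exact analyticOrderAt_pow (h1 (p i)) (k i)

lemma exists_sigmaProd_add {N : ℕ} (k : Fin r → ℕ) (a : Fin N → ℂ) {ω : ℂ} (hω : ω ∈ L.lattice) :
    ∃ C : ℂ, C ≠ 0 ∧ ∀ z, sigmaProd L p k a (z + ω) =
      C * exp ((N + ∑ i, (k i : ℂ)) * quasiPeriod L ω * z) * sigmaProd L p k a z := by
  obtain ⟨C, hC0, hC⟩ := exists_sigma_add hω
  set η := quasiPeriod L ω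
  have h1 : ∀ a z, sigma L (z + ω - a) = (C * exp (-(η * a))) * exp (η * z) * sigma L (z - a) := by
    intro a z
    rw [show z + ω - a = z - a + ω by ring, hC, mul_sub, sub_eq_add_neg, exp_add]
    ring
  refine ⟨(∏ μ, (C * exp (-(η * a μ)))) * ∏ i, (C * exp (-(η * p i))) ^ k i,
    mul_ne_zero (Finset.prod_ne_zero_iff.2 fun μ _ ↦ mul_ne_zero hC0 (exp_ne_zero _))
      (Finset.prod_ne_zero_iff.2 fun i _ ↦ pow_ne_zero _ (mul_ne_zero hC0 (exp_ne_zero _))),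
    fun z ↦ ?_⟩
  simp only [sigmaProd, h1, mul_pow, Finset.prod_mul_distrib]
  have h2 : exp ((N + ∑ i, (k i : ℂ)) * η * z) =
      (∏ _μ : Fin N, exp (η * z)) * ∏ i, exp (η * z) ^ k i := by
    rw [Finset.prod_const, Finset.card_univ, Fintype.card_fin, Finset.prod_pow_eq_pow_sum,
      ← exp_nat_mul, ← exp_nat_mul, ← exp_add]
    congr 1
    push_cast
    ring
  rw [h2]
  ring

/-- The orders of `y` are `Λ`-periodic and restricted by the indicial equation, so a finite product
of sigma functions has exactly the same zeros with multiplicity. The quotient is handled by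
`exists_exp_of_quasiperiodic`, whose conclusion `κ = 0` is the weight count. -/
theorem exists_factorization (hp : ∀ i j, i ≠ j → p i - p j ∉ L.lattice) {y : ℂ → ℂ}
    (hy : ∀ z, LocSol (gauge L n p) (potential L n p A B) y z) (hy0 : y ≠ 0)
    (hper : ∀ ω, ω = L.ω₁ ∨ ω = L.ω₂ → ∃ μ : ℂ, μ ≠ 0 ∧
        ∀ z, y (z + ω) = μ * exp ((∑ i, n i) * quasiPeriod L ω * z) * y z) :
    ∃ (k : Fin r → ℕ) (N : ℕ) (a : Fin N → ℂ) (C h : ℂ),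
      (∀ i, (k i : ℂ) * (k i - 1 - 2 * n i) = 0) ∧
      (∀ μ κ, μ ≠ κ → a μ - a κ ∉ L.lattice) ∧ (∀ μ i, a μ - p i ∉ L.lattice) ∧
      ∑ i, n i = N + ∑ i, (k i : ℂ) ∧ C ≠ 0 ∧
      ∀ z, y z = C * exp (h * z) * sigmaProd L p k a z := by
  classical
  have hyd := differentiable_of_locSol hy
  have hnz : ∀ c, ¬ ∀ᶠ z in 𝓝 c, y z = 0 := fun c h ↦ hy0 (eq_zero_of_eventually hy h)
  have hordper : ∀ l ∈ L.lattice, Function.Periodic (analyticOrderAt y) l := by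
    have h1 : ∀ ω, ω = L.ω₁ ∨ ω = L.ω₂ → Function.Periodic (analyticOrderAt y) ω := by
      intro ω hω
      obtain ⟨μ, hμ, h⟩ := hper ω hω
      exact analyticOrderAt_periodic hyd (by fun_prop)
        (fun z ↦ mul_ne_zero hμ (exp_ne_zero _)) h
    exact fun l hl ↦ periodic_of_generators (h1 _ (.inl rfl)) (h1 _ (.inr rfl)) hl
  have hsing : ∀ i, ∃ k : ℕ, analyticOrderAt y (p i) = k ∧ (k : ℂ) * (k - 1 - 2 * n i) = 0 :=
    fun i ↦ (hy (p i)).analyticOrderAt (locData_lame hp (by simp)) (hnz _)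
  choose k hk hk' using hsing
  have hreg : ∀ c, (∀ i, c - p i ∉ L.lattice) → y c = 0 → analyticOrderAt y c = 1 := by
    intro c hc hyc
    obtain ⟨m, hm, hm'⟩ := (hy c).analyticOrderAt
      (locData_zero (analyticAt_gauge hc) (analyticAt_potential hc)) (hnz c)
    rcases mul_eq_zero.1 hm' with h | h
    · have h0 : m = 0 := by exact_mod_cast h
      rw [h0, Nat.cast_zero, (hy c).1.analyticOrderAt_eq_zero] at hm
      exact absurd hyc hm
    · have h1 : (m : ℂ) = 1 := by linear_combination h
      rw [hm]
      exact_mod_cast h1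
  have hzero : ∀ c, y c = 0 ↔ analyticOrderAt y c ≠ 0 := fun c ↦ by
    rw [ne_eq, (hy c).1.analyticOrderAt_eq_zero, not_not]
  obtain ⟨N, a, haZ, hadist, hacov⟩ := exists_representatives (L := L)
    (Z := {z | y z = 0 ∧ ∀ i, z - p i ∉ L.lattice}) (fun z hz l hl ↦ by
      refine ⟨?_, fun i h ↦ hz.2 i ?_⟩
      · rw [hzero, (hordper l hl).sub_eq, ← hzero]
        exact hz.1
      · rw [show z - p i = z - l - p i + l by ring]
        exact L.lattice.add_mem h hl)
    (fun R ↦ (finite_zeros hyd hy0 R).subset fun z hz ↦ ⟨hz.1.1, hz.2⟩)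
  have hord : ∀ c, analyticOrderAt y c = analyticOrderAt (sigmaProd L p k a) c := by
    intro c
    rw [analyticOrderAt_sigmaProd]
    by_cases hc : ∀ i, c - p i ∉ L.lattice
    · rw [Finset.sum_eq_zero (s := (Finset.univ : Finset (Fin r))) (fun i _ ↦ by simp [hc i]), add_zero]
      by_cases hyc : y c = 0
      · obtain ⟨μ, hμ⟩ := hacov c ⟨hyc, hc⟩
        rw [hreg c hc hyc, Finset.sum_eq_single μ (fun κ _ hκ ↦ ?_) (by simp), if_pos hμ]
        rw [if_neg]
        intro h
        exact hadist κ μ hκ (by simpa using L.lattice.sub_mem hμ h)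
      · rw [(hy c).1.analyticOrderAt_eq_zero.2 hyc, Finset.sum_eq_zero fun μ _ ↦ ?_]
        rw [if_neg]
        intro h
        apply hyc
        rw [hzero, show c = a μ + (c - a μ) by ring, hordper _ h, ← hzero]
        exact (haZ μ).1
    · push Not at hc
      obtain ⟨i, hi⟩ := hc
      rw [Finset.sum_eq_zero (fun μ _ ↦ ?_), zero_add,
        Finset.sum_eq_single i (fun j _ hj ↦ ?_) (by simp), if_pos hi]
      · rw [show c = p i + (c - p i) by ring, hordper _ hi, hk]
        simp
      · rw [if_neg, smul_zero]
        intro h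
        exact hp i j hj.symm (by simpa using L.lattice.sub_mem h hi)
      · rw [if_neg]
        intro h
        exact (haZ μ).2 i (by simpa using L.lattice.sub_mem hi h)
  have hne : ∀ c, ∀ᶠ z in 𝓝[≠] c, sigmaProd L p k a z ≠ 0 := fun c ↦ by
    filter_upwards [eventually_regular L p c, eventually_regular L a c] with z h1 h2
      using sigmaProd_ne_zero h2 h1
  have hDd := differentiable_sigmaProd L p k a
  obtain ⟨g, hgd, hg0, hg⟩ := exists_factor hyd hDd hord fun c htop ↦ by
    obtain ⟨z, h1, h2⟩ := ((hne c).and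
      (nhdsWithin_le_nhds (analyticOrderAt_eq_top.1 htop))).exists
    exact h1 h2
  obtain ⟨hκ, C, h, hC, hgexp⟩ := exists_exp_of_quasiperiodic (L := L) hgd hg0
    (κ := ∑ i, n i - (N + ∑ i, (k i : ℂ))) (fun ω hω ↦ by
      obtain ⟨μ, hμ, hyω⟩ := hper ω hω
      have hωL : ω ∈ L.lattice := by
        rcases hω with rfl | rfl
        · exact L.ω₁_mem_lattice
        · exact L.ω₂_mem_lattice
      obtain ⟨D, hD, hDω⟩ := exists_sigmaProd_add (p := p) k a hωL
      refine ⟨μ / D, fun z ↦ ?_⟩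
      -- The sigma product can be cancelled only off its zeros; density and continuity give the
      -- relation for `g` everywhere.
      have hdense : Dense {z | sigmaProd L p k a z ≠ 0} := fun c ↦ by
        rw [mem_closure_iff_frequently]
        exact (hne c).frequently.filter_mono nhdsWithin_le_nhds
      have hgc := hgd.continuous
      refine congrFun (Continuous.ext_on hdense (f := fun z ↦ g (z + ω)) (g := fun z ↦ μ / D *
        exp ((∑ i, n i - (N + ∑ i, (k i : ℂ))) * quasiPeriod L ω * z) * g z)
        (by fun_prop) (by fun_prop) fun z hz ↦ ?_) z
      have h1 := hyω z
      rw [hg, hg z, hDω] at h1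
      have hz' : sigmaProd L p k a z ≠ 0 := hz
      have h2 : g (z + ω) * (D * exp ((N + ∑ i, (k i : ℂ)) * quasiPeriod L ω * z)) =
          μ * exp ((∑ i, n i) * quasiPeriod L ω * z) * g z := by
        apply mul_right_cancel₀ hz'
        linear_combination h1
      have h3 := exp_ne_zero ((N + ∑ i, (k i : ℂ)) * quasiPeriod L ω * z)
      simp only
      rw [sub_mul, sub_mul, exp_sub]
      generalize exp ((N + ∑ i, (k i : ℂ)) * quasiPeriod L ω * z) = E₁ at h2 h3 ⊢
      generalize exp ((∑ i, n i) * quasiPeriod L ω * z) = E₂ at h2 ⊢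
      field_simp
      linear_combination h2)
  exact ⟨k, N, a, C, h, hk', hadist, fun μ ↦ (haZ μ).2, sub_eq_zero.1 hκ, hC, fun z ↦ by
    rw [hg, hgexp]⟩

end

/-! ### The exponent `h` and the branches of the ansatz -/

lemma deriv_deriv_sigma_zero (L : PeriodPair) : deriv (deriv (sigma L)) 0 = 0 := by
  have h1 : ∀ z, deriv (sigma L) (-z) = deriv (sigma L) z := by
    intro z
    have h2 : deriv (fun x ↦ sigma L (-x)) z = -deriv (sigma L) (-z) := deriv_comp_neg _ _
    rw [funext (sigma_neg L), deriv.fun_neg] at h2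
    linear_combination h2
  have h3 : deriv (fun x ↦ deriv (sigma L) (-x)) 0 = -deriv (deriv (sigma L)) (-0) :=
    deriv_comp_neg _ _
  rw [funext h1, neg_zero] at h3
  linear_combination h3 / 2

section

variable {L : PeriodPair} {r : ℕ} {n p A : Fin r → ℂ} {B : ℂ}

/-- `LocSol` speaks only of a punctured neighbourhood; at a regular point the defect is analytic, so
the equation holds at the point too. -/
lemma odeDefect_eq_zero_of_regular {y : ℂ → ℂ} {z : ℂ}
    (hy : LocSol (gauge L n p) (potential L n p A B) y z) (hz : ∀ i, z - p i ∉ L.lattice) :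
    odeDefect (gauge L n p) (potential L n p A B) y z = 0 := by
  have h1 : AnalyticAt ℂ (odeDefect (gauge L n p) (potential L n p A B) y) z := by
    have hP := analyticAt_gauge (n := n) hz
    have hP' := hP.deriv
    have hQ := analyticAt_potential (n := n) (A := A) (B := B) hz
    have h2 := hy.1
    have h3 := h2.deriv
    have h4 := h3.deriv
    unfold odeDefect
    fun_prop
  exact (h1.frequently_zero_iff_eventually_zero.1 hy.2.frequently).self_of_nhds

lemma logDeriv_sigma_sub {a z : ℂ} (hz : z - a ∉ L.lattice) :
    logDeriv (fun z ↦ sigma L (z - a)) z = zeta L (z - a) := by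
  rw [logDeriv_apply, ((hasDerivAt_sigma hz).comp_sub_const z a).deriv,
    mul_div_cancel_right₀ _ (sigma_ne_zero hz)]

/-- At a simple zero `c` of a solution, the remaining factor has logarithmic derivative `P`. -/
lemma logDeriv_eq_gauge {y T : ℂ → ℂ} {c : ℂ}
    (hy : LocSol (gauge L n p) (potential L n p A B) y c) (hc : ∀ i, c - p i ∉ L.lattice)
    (hT : Differentiable ℂ T) (hTc : T c ≠ 0) (hyT : ∀ z, y z = sigma L (z - c) * T z) :
    logDeriv T c = gauge L n p c := by
  have hT' : Differentiable ℂ (deriv T) := fun z ↦ (hT.analyticAt z).deriv.differentiableAt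
  have hσ' : Differentiable ℂ (deriv (sigma L)) := fun z ↦
    (analyticAt_sigma L z).deriv.differentiableAt
  have d1 : deriv y = fun z ↦ deriv (sigma L) (z - c) * T z + sigma L (z - c) * deriv T z := by
    ext z
    rw [funext hyT]
    exact (((differentiable_sigma L _).hasDerivAt.comp_sub_const z c).mul (hT z).hasDerivAt).deriv
  have d2 : deriv (deriv y) c = 2 * deriv T c := by
    rw [d1]
    have h1 := ((((hσ' _).hasDerivAt.comp_sub_const c c).mul (hT c).hasDerivAt).add
      (((differentiable_sigma L _).hasDerivAt.comp_sub_const c c).mul (hT' c).hasDerivAt)).deriv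
    refine h1.trans ?_
    rw [sub_self, deriv_deriv_sigma_zero, deriv_sigma_zero, sigma_zero]
    ring
  -- With `y(c) = 0`, `y'(c) = T(c)` and `y''(c) = 2 T'(c)` the equation reads `2 T'(c) = 2 P(c)
  -- T(c)`.
  have h0 := odeDefect_eq_zero_of_regular hy hc
  rw [odeDefect, d2, congrFun d1 c, hyT c, sub_self, deriv_sigma_zero, sigma_zero] at h0
  rw [logDeriv_apply, div_eq_iff hTc]
  linear_combination h0 / 2

/-- The double sum is antisymmetric since `ζ` is odd. The diagonal may be included because the value
of `zeta` at `0` is `0`. -/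
lemma sum_zeta_sub_eq_zero (L : PeriodPair) {N : ℕ} (a : Fin N → ℂ) :
    ∑ μ, ∑ κ ∈ Finset.univ.erase μ, zeta L (a μ - a κ) = 0 := by
  have h0 : zeta L 0 = 0 := by
    have := zeta_neg L 0
    rw [neg_zero] at this
    linear_combination this / 2
  have h1 : ∀ μ, ∑ κ ∈ Finset.univ.erase μ, zeta L (a μ - a κ) = ∑ κ, zeta L (a μ - a κ) := by
    intro μ
    rw [← Finset.add_sum_erase _ _ (Finset.mem_univ μ), sub_self, h0, zero_add]
  simp only [h1]
  have h2 : ∑ μ, ∑ κ, zeta L (a μ - a κ) = -∑ μ, ∑ κ, zeta L (a μ - a κ) := by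
    conv_lhs => rw [Finset.sum_comm]
    rw [← Finset.sum_neg_distrib]
    refine Finset.sum_congr rfl fun μ _ ↦ ?_
    rw [← Finset.sum_neg_distrib]
    refine Finset.sum_congr rfl fun κ _ ↦ ?_
    rw [← zeta_neg, neg_sub]
  linear_combination h2 / 2

/-- By `logDeriv_eq_gauge` the cofactor of `σ(z - a_μ)` in `y` has logarithmic derivative `P(a_μ)`
at `a_μ`, which expresses `h` for each `μ`. In the mean over `μ` the mutual terms cancel. -/
lemma exponent_eq {y : ℂ → ℂ} {k : Fin r → ℕ} {N : ℕ} {a : Fin N → ℂ} {C h : ℂ}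
    (hy : ∀ z, LocSol (gauge L n p) (potential L n p A B) y z)
    (hdist : ∀ μ κ, μ ≠ κ → a μ - a κ ∉ L.lattice) (hreg : ∀ μ i, a μ - p i ∉ L.lattice)
    (hC : C ≠ 0) (hyz : ∀ z, y z = C * exp (h * z) * sigmaProd L p k a z) (hN : 0 < N) :
    h = (1 / (N : ℂ)) * ∑ μ, ∑ i, (n i - k i) * zeta L (a μ - p i) := by
  have key : ∀ μ, h = ∑ i, (n i - k i) * zeta L (a μ - p i) -
      ∑ κ ∈ Finset.univ.erase μ, zeta L (a μ - a κ) := by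
    intro μ
    set S : ℂ → ℂ := fun z ↦ ∏ κ ∈ Finset.univ.erase μ, sigma L (z - a κ) with hS
    set U : ℂ → ℂ := fun z ↦ ∏ i, sigma L (z - p i) ^ k i with hU
    have hother : ∀ κ ∈ Finset.univ.erase μ, a μ - a κ ∉ L.lattice := fun κ hκ ↦
      hdist μ κ (Finset.ne_of_mem_erase hκ).symm
    have hSd : Differentiable ℂ S :=
      Differentiable.fun_finsetProd fun κ _ ↦ differentiable_sigma_sub L (a κ)
    have hUd : Differentiable ℂ U :=
      Differentiable.fun_finsetProd fun i _ ↦ (differentiable_sigma_sub L (p i)).pow (k i)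
    have hS0 : S (a μ) ≠ 0 := Finset.prod_ne_zero_iff.2 fun κ hκ ↦ sigma_ne_zero (hother κ hκ)
    have hU0 : U (a μ) ≠ 0 :=
      Finset.prod_ne_zero_iff.2 fun i _ ↦ pow_ne_zero _ (sigma_ne_zero (hreg μ i))
    have hEd : Differentiable ℂ fun z ↦ C * exp (h * z) := by fun_prop
    have hE0 : C * exp (h * a μ) ≠ 0 := mul_ne_zero hC (exp_ne_zero _)
    have h1 := logDeriv_eq_gauge (T := fun z ↦ C * exp (h * z) * (S z * U z)) (hy (a μ)) (hreg μ)
      (hEd.mul (hSd.mul hUd)) (mul_ne_zero hE0 (mul_ne_zero hS0 hU0)) (fun z ↦ by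
        rw [hyz, sigmaProd, ← Finset.mul_prod_erase _ _ (Finset.mem_univ μ)]
        ring)
    have hlE : logDeriv (fun z ↦ C * exp (h * z)) (a μ) = h := by
      have h2 := (((hasDerivAt_id (a μ)).const_mul h).cexp.const_mul C).deriv
      rw [logDeriv_apply, div_eq_iff hE0]
      refine h2.trans ?_
      simp only [id]; ring
    have hlS : logDeriv S (a μ) = ∑ κ ∈ Finset.univ.erase μ, zeta L (a μ - a κ) := by
      have h2 := logDeriv_prod (s := Finset.univ.erase μ) (f := fun κ z ↦ sigma L (z - a κ))
        (x := a μ) (fun κ hκ ↦ sigma_ne_zero (hother κ hκ))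
        (fun κ _ ↦ differentiable_sigma_sub L (a κ) _)
      exact h2.trans (Finset.sum_congr rfl fun κ hκ ↦ logDeriv_sigma_sub (hother κ hκ))
    have hlU : logDeriv U (a μ) = ∑ i, k i * zeta L (a μ - p i) := by
      have h2 := logDeriv_prod (s := Finset.univ) (f := fun i z ↦ sigma L (z - p i) ^ k i)
        (x := a μ) (fun i _ ↦ pow_ne_zero _ (sigma_ne_zero (hreg μ i)))
        (fun i _ ↦ ((differentiable_sigma_sub L (p i)).pow (k i)) _)
      refine h2.trans (Finset.sum_congr rfl fun i _ ↦ ?_)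
      rw [logDeriv_fun_pow (differentiable_sigma_sub L (p i) _), logDeriv_sigma_sub (hreg μ i)]
    rw [logDeriv_mul (f := fun z ↦ C * exp (h * z)) (g := fun z ↦ S z * U z) (a μ) hE0
        (mul_ne_zero hS0 hU0) (hEd _) ((hSd.mul hUd) _),
      logDeriv_mul (f := S) (g := U) (a μ) hS0 hU0 (hSd _) (hUd _), hlE, hlS, hlU, gauge] at h1
    simp only [sub_mul, Finset.sum_sub_distrib]
    linear_combination h1
  have hN' : (N : ℂ) ≠ 0 := by exact_mod_cast hN.ne'
  have hsum := Finset.sum_congr (rfl : (Finset.univ : Finset (Fin N)) = Finset.univ)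
    fun μ _ ↦ key μ
  rw [Finset.sum_sub_distrib, sum_zeta_sub_eq_zero, sub_zero, Finset.sum_const, Finset.card_univ,
    Fintype.card_fin, nsmul_eq_mul] at hsum
  rw [← hsum]
  field_simp

/-- The logarithms `ℓ_i` that define the branch also define a branch `E = C exp(∑ n_i ℓ_i)` with `E'
= P E` and `y = w E`, so the equation for `y` becomes that for `w`. -/
lemma isSolutionOn_of_isBranchOn {y : ℂ → ℂ} {k : Fin r → ℕ} {N : ℕ} {a : Fin N → ℂ} {C h : ℂ}
    (hy : ∀ z, LocSol (gauge L n p) (potential L n p A B) y z)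
    (hC : C ≠ 0) (hyz : ∀ z, y z = C * exp (h * z) * sigmaProd L p k a z) {U : Set ℂ}
    (hU : IsOpen U) {w : ℂ → ℂ} (hw : IsBranchOn L (fun i ↦ n i - k i) p a h U w) :
    IsSolutionOn (potential L n p A B) U w := by
  obtain ⟨ℓ, hℓ, hwz⟩ := hw
  -- The domain of a branch avoids `p_i + Λ` automatically, as `exp` has no zeros.
  have hreg : ∀ z ∈ U, ∀ i, z - p i ∉ L.lattice := fun z hz i hmem ↦
    exp_ne_zero (ℓ i z) (((hℓ i).2 z hz).trans ((sigma_eq_zero_iff L _).2 hmem))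
  have hℓd : ∀ z ∈ U, ∀ i, HasDerivAt (ℓ i) (zeta L (z - p i)) z := by
    intro z hz i
    have h1 := ((hℓ i).1.differentiableAt (hU.mem_nhds hz)).hasDerivAt
    have h2 : (fun z ↦ exp (ℓ i z)) =ᶠ[𝓝 z] fun z ↦ sigma L (z - p i) := by
      filter_upwards [hU.mem_nhds hz] with x hx using (hℓ i).2 x hx
    have h3 := h2.deriv_eq
    rw [h1.cexp.deriv, ((hasDerivAt_sigma (hreg z hz i)).comp_sub_const z (p i)).deriv,
      (hℓ i).2 z hz, mul_comm] at h3
    rwa [mul_right_cancel₀ (sigma_ne_zero (hreg z hz i)) h3] at h1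
  set E : ℂ → ℂ := fun z ↦ C * exp (∑ i, n i * ℓ i z) with hE
  have hEd : ∀ z ∈ U, HasDerivAt E (gauge L n p z * E z) z := by
    intro z hz
    have h1 := ((HasDerivAt.fun_sum fun i (_ : i ∈ Finset.univ) ↦
      (hℓd z hz i).const_mul (n i)).cexp).const_mul C
    exact h1.congr_deriv (by simp only [hE, gauge]; ring)
  have hE0 : ∀ z, E z ≠ 0 := fun z ↦ mul_ne_zero hC (exp_ne_zero _)
  have hyw : ∀ z ∈ U, y z = w z * E z := by
    intro z hz
    have h1 : ∏ i, exp ((n i - k i) * ℓ i z) * sigma L (z - p i) ^ k i = exp (∑ i, n i * ℓ i z) := by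
      rw [exp_sum]
      refine Finset.prod_congr rfl fun i _ ↦ ?_
      rw [← (hℓ i).2 z hz, ← exp_nat_mul, ← exp_add]
      congr 1
      ring
    rw [Finset.prod_mul_distrib] at h1
    have h2 : ∏ i, exp ((n i - k i) * ℓ i z) ≠ 0 :=
      Finset.prod_ne_zero_iff.2 fun i _ ↦ exp_ne_zero _
    rw [hwz z hz, hyz, sigmaProd]
    simp only [hE]
    rw [← h1]
    field_simp
  have hwE : ∀ z ∈ U, w z = y z / E z := fun z hz ↦ by rw [hyw z hz, mul_div_cancel_right₀ _ (hE0 z)]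
  have hwd : DifferentiableOn ℂ w U := by
    have h1 : DifferentiableOn ℂ (fun z ↦ y z / E z) U := fun z hz ↦
      ((hy z).1.differentiableAt.div (hEd z hz).differentiableAt (hE0 z)).differentiableWithinAt
    exact h1.congr hwE
  refine ⟨hwd, fun z hz ↦ ?_⟩
  have hUz := hU.mem_nhds hz
  have h1 := odeDefect_of_mul (P := gauge L n p) (Q := potential L n p A B) (w := w) (E := E) (y := y)
    (analyticAt_gauge (hreg z hz)).differentiableAt
    (by filter_upwards [hUz] with x hx using hwd.differentiableAt (hU.mem_nhds hx))
    ((hwd.deriv hU).differentiableAt hUz)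
    (by filter_upwards [hUz] with x hx using hEd x hx)
    (by filter_upwards [hUz] with x hx using hyw x hx)
  rw [odeDefect_eq_zero_of_regular (hy z) (hreg z hz)] at h1
  exact sub_eq_zero.1 ((mul_eq_zero.1 h1.symm).resolve_right (hE0 z))

end

lemma exists_branch (L : PeriodPair) {r N : ℕ} (ν p : Fin r → ℂ) (a : Fin N → ℂ) (h : ℂ) {z₀ : ℂ}
    (hz₀ : ∀ i, z₀ - p i ∉ L.lattice) :
    ∃ U : Set ℂ, IsOpen U ∧ z₀ ∈ U ∧ ∃ w : ℂ → ℂ, IsBranchOn L ν p a h U w := by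
  have hne : ∀ i, sigma L (z₀ - p i) ≠ 0 := fun i ↦ sigma_ne_zero (hz₀ i)
  have hd : ∀ i, Differentiable ℂ fun z ↦ sigma L (z - p i) / sigma L (z₀ - p i) := fun i ↦
    (differentiable_sigma_sub L (p i)).div_const _
  -- Normalized to be `1` at `z₀`, the sigma quotients stay in the slit plane nearby, where the
  -- principal logarithm is holomorphic.
  refine ⟨⋂ i, (fun z ↦ sigma L (z - p i) / sigma L (z₀ - p i)) ⁻¹' slitPlane,
    isOpen_iInter_of_finite fun i ↦ isOpen_slitPlane.preimage (hd i).continuous,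
    Set.mem_iInter.2 fun i ↦ ?_, _,
    fun i z ↦ log (sigma L (z - p i) / sigma L (z₀ - p i)) + log (sigma L (z₀ - p i)),
    fun i ↦ ⟨fun z hz ↦ ?_, fun z hz ↦ ?_⟩, fun z _ ↦ rfl⟩
  · simp [div_self (hne i)]
  · exact (((hd i) z).clog (Set.mem_iInter.1 hz i)).add_const _ |>.differentiableWithinAt
  · rw [exp_add, exp_log (slitPlane_ne_zero (Set.mem_iInter.1 hz i)), exp_log (hne i),
      div_mul_cancel₀ _ (hne i)]

end GenLame
end

theorem proposition2p5 (τ : UpperHalfPlane) (r : ℕ) (n p A : Fin r → ℂ) (B : ℂ)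
    (hp : ∀ i j, i ≠ j → p i - p j ∉ (GenLame.periods τ).lattice)
    (hA : ∑ i, A i = 0)
    (hn : ∀ i, ∃ m : ℕ, n i = (m : ℂ) / 2)
    (htot : ∃ k : ℤ, ∑ i, n i = (k : ℂ))
    (hlog : ∀ i, GenLame.LogFreeAt (GenLame.potential (GenLame.periods τ) n p A B) (p i) (n i)) :
    ∃ (ν : Fin r → ℂ) (N : ℕ) (a : Fin N → ℂ) (h : ℂ),
      (∀ i, ν i = n i ∨ ν i = -n i - 1) ∧
      GenLame.IsAnsatzData (GenLame.periods τ) ν p a h ∧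
      GenLame.IsMultivaluedSolution (GenLame.periods τ)
        (GenLame.potential (GenLame.periods τ) n p A B) ν p a h := by
  obtain ⟨y, hy, hy0, hper⟩ := GenLame.exists_quasiperiodic_solution hA htot
    (GenLame.goodEquation_lame hp hA hn hlog)
  obtain ⟨k, N, a, C, h, hk, hdist, hreg, htotal, hC, hyz⟩ :=
    GenLame.exists_factorization hp hy hy0 hper
  -- The order `k i` of `y` at `p i` is `0` or `2 n_i + 1`, so the weight `n_i - k_i` is `n_i` or
  -- `-n_i - 1`.
  refine ⟨fun i ↦ n i - k i, N, a, h, fun i ↦ ?_, ⟨?_, hdist, hreg, fun hN ↦ ?_⟩,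
    fun z₀ hz₀ ↦ GenLame.exists_branch _ _ _ _ _ hz₀,
    fun U hU w hw ↦ GenLame.isSolutionOn_of_isBranchOn hy hC hyz hU hw⟩
  · rcases mul_eq_zero.1 (hk i) with h0 | h0
    · left
      simp [h0]
    · right
      linear_combination -h0
  · rw [Finset.sum_sub_distrib, htotal]
    ring
  · exact GenLame.exponent_eq hy hdist hreg hC hyz hN
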